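/- **Setting.** Let $n\ge 2$. Let $\mathcal T$ be a finite collection of copies $\Delta$ of a $3$-simplex with ordered vertices $0,1,2,3$, whose faces are glued in pairs (no face to itself) by affine face pairings that are compatible with an orientation, with connected quotient. Truncating the vertices gives a compact, connected, oriented $3$-manifold $M$, whose boundary components are the links of the vertices of $\mathcal T$. (If a vertex of $\mathcal T$ is meant to be an interior point, its link is a sphere, and filling it in changes neither $\pi_1(M)$ nor the statement.) Truncating the edges as well decomposes $M$ into doubly truncated simplices and prisms around the edges of $\mathcal T$, and $\partial M$ into the hexagons of the doubly truncated simplices near the vertices and the polygonal ends of the prisms. The vertices of the doubly truncated $\Delta$ are the triples $v_0v_1v_2$ of distinct vertices of $\Delta$ (the vertex near $v_0$, the edge $v_0v_1$ and the face $v_0v_1v_2$); long, middle and short edges join $v_0v_1v_2$ to $v_1v_0v_2$, $v_0v_2v_1$ and $v_0v_1v_3$, respectively, where $\{v_0,v_1,v_2,v_3\}=\{0,1,2,3\}$. Face pairings identify the long and the middle edges of paired faces. The edges in $\partial M$ are the middle and the short edges. Fundamental groups are computed by edge paths, and a $G$-cocycle is a $G$-labeling of the oriented edges for which reversal inverts labels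 and the product around every $2$-cell is $1$. Let $B$ and $N$ be the images in $\mathrm{PGL}(n,\mathbb C)$ of the invertible upper triangular matrices and of the upper triangular matrices with ones on the diagonal, and let $q_1$ be the counter-diagonal matrix of ones. Let $D$ be a $\mathrm{PGL}(n,\mathbb C)/B$-decoration of $\mathcal T$: cosets $(g_0B,\dots,g_3B)$ for each $\Delta$, with $g_i$ lifted to $\mathrm{GL}(n,\mathbb C)$, such that the cosets on two identified faces differ by left multiplication by a unique element. Assume that $D$ is generic: for each $\Delta$ and all integers $t_i\ge0$ with $\sum t_i=n$, the determinant $c_t$ of the matrix formed by the first $t_0$ columns of $g_0$, the first $t_1$ of $g_1$, the first $t_2$ of $g_2$ and the first $t_3$ of $g_3$ is nonzero. Its natural cocycle $\sigma$ is the $\mathrm{PGL}(n,\mathbb C)$-cocycle on $M$ which on each doubly truncated simplex is $\langle v,w\rangle\mapsto(\tau^{v})^{-1}\tau^{w}$, where $(g_{v_0}B,g_{v_1}B,g_{v_2}B)=\tau^{v_0v_1v_2}(B,q_1B,mB)$ with $m$ lower triangular, with ones on the diagonal and in the first column. For integer points $s\ge0$ with $\sum s_i=n-2$, the shape parameters of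 $\Delta$ are $$z_s^{1100}=z_s^{0011}=\tfrac{c_{s+1001}c_{s+0110}}{c_{s+1010}c_{s+0101}},\quad z_s^{0110}=z_s^{1001}=\tfrac{c_{s+0101}c_{s+1010}}{c_{s+1100}c_{s+0011}},\quad z_s^{1010}=z_s^{0101}=-\tfrac{c_{s+1100}c_{s+0011}}{c_{s+1001}c_{s+0110}},$$ and $X_t=-\prod_{s+e=t}z^e_s$ is the $X$-coordinate at a point $t$ in the interior of a face. Let $\varepsilon=\varepsilon^{v_0v_1v_2}=\pm1$ be the sign of the permutation $i\mapsto v_i$ of $\{0,1,2,3\}$. Let $\rho\colon\pi_1(M)\to\mathrm{PGL}(n,\mathbb C)$ be the representation determined, up to conjugation, by $\sigma$ (products of labels along edge paths). It is *boundary-unipotent* if it takes each peripheral curve to a conjugate of an element of $N$. For each boundary component choose a base point and a set of closed edge paths in $\partial M$ that represent generators of its fundamental group. **Statement.** The restriction of $\sigma$ to $\partial M$ has exactly one lift to a $\mathrm{GL}(n,\mathbb C)$-cocycle whose labels $\beta$ of middle edges are upper triangular with last column consisting of ones and whose labels $\gamma$ of short edges are diagonal with last diagonal entry $1$. Let $\beta_j$,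 $\gamma_j$ be the labels of this lift on the middle and short edges traversed by a closed edge path $\lambda$ in $\partial M$. The level $l$ cusp equation of $\lambda$, $1\le l\le n-1$, is $$\prod_j(\beta_j)_{ll}\prod_j(\gamma_j)_{ll}=1 .$$ 1. The following are equivalent: (a) $\rho$ is boundary-unipotent; (b) $\rho$ takes each peripheral subgroup into a conjugate of $N$; (c) for every $l=1,\dots,n-1$, the level $l$ cusp equation holds for each of the chosen edge paths. 2. For each closed edge path $\lambda$ in $\partial M$, the cusp equations of $\lambda$ at all levels $l=1,\dots,n-1$ are together equivalent to the equations $$\prod_j\frac{(\beta_j)_{ll}}{(\beta_j)_{l+1,l+1}}\prod_j\frac{(\gamma_j)_{ll}}{(\gamma_j)_{l+1,l+1}}=1,\qquad l=1,\dots,n-1 .$$ 3. If the edge starts at the vertex $v_0v_1v_2$ of the doubly truncated simplex $\Delta$, the factors are $$\frac{(\beta_j)_{ll}}{(\beta_j)_{l+1,l+1}}=-\prod_{k=1}^{n-1-l}\Big(X_{k v_2+l v_0+(n-k-l)v_1}\Big)^{\varepsilon},\qquad \frac{(\gamma_j)_{ll}}{(\gamma_j)_{l+1,l+1}}=\Big(z^{v_0+v_1}_{(l-1)v_0+(n-1-l)v_1}\Big)^{-\varepsilon},$$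 with the coordinates of $\Delta$ (for a middle edge, of either of the two simplices containing it). So the cusp equations are equivalent to products of $X$-coordinates, shape parameters and signs being equal to $1$. -/

import Mathlib

open scoped MatrixGroups

noncomputable section

/-! ## Polyhedral complexes, edge paths, fundamental groups and cocycles -/

/-- The 2-skeleton of a polyhedral complex: vertices, oriented edges, the orientation reversal of
edges, and the boundary words of the oriented 2-cells (`Face w` says that the closed edge path `w`
runs once around a 2-cell). -/
structure PolyComplex where
  V : Type
  E : Type
  src : E → V
  tgt : E → V
  rev : E → E
  rev_rev : ∀ e, rev (rev e) = e
  src_rev : ∀ e, src (rev e) = tgt e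
  Face : List E → Prop

namespace PolyComplex

variable (K : PolyComplex)

/-- `K.IsPath x y w`: the edges in the list `w` form an edge path from `x` to `y`. -/
def IsPath : K.V → K.V → List K.E → Prop
  | x, y, [] => x = y
  | x, y, e :: w => K.src e = x ∧ IsPath (K.tgt e) y w

/-- The reversed word. -/
def inv (w : List K.E) : List K.E := (w.map K.rev).reverse

/-- The words that may be deleted from an edge path: a backtracking `e e⁻¹`, and the boundary of a
2-cell in either direction. -/
def Contractible (c : List K.E) : Prop :=
  (∃ e, c = [e, K.rev e]) ∨ K.Face c ∨ K.Face (K.inv c)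

/-- An elementary homotopy of edge paths: the deletion of a contractible word. -/
def Step (w w' : List K.E) : Prop :=
  ∃ u c v, K.Contractible c ∧ w = u ++ c ++ v ∧ w' = u ++ v

variable {K}

theorem tgt_rev (e : K.E) : K.tgt (K.rev e) = K.src e := by
  rw [← K.src_rev, K.rev_rev]

theorem IsPath.append {x y z : K.V} {w w' : List K.E} (h : K.IsPath x y w)
    (h' : K.IsPath y z w') : K.IsPath x z (w ++ w') := by
  induction w generalizing x with
  | nil => cases h; exact h'
  | cons e w ih => exact ⟨h.1, ih h.2⟩

theorem inv_cons (e : K.E) (w : List K.E) : K.inv (e :: w) = K.inv w ++ [K.rev e] := by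
  simp [inv]

theorem inv_append (w w' : List K.E) : K.inv (w ++ w') = K.inv w' ++ K.inv w := by
  simp [inv]

theorem inv_inv (w : List K.E) : K.inv (K.inv w) = w := by
  have : K.rev ∘ K.rev = id := funext K.rev_rev
  simp [inv, List.map_reverse, this]

theorem IsPath.inv {x y : K.V} {w : List K.E} (h : K.IsPath x y w) :
    K.IsPath y x (K.inv w) := by
  induction w generalizing x with
  | nil => exact h.symm
  | cons e w ih =>
    rw [inv_cons]
    exact (ih h.2).append ⟨K.src_rev e, (tgt_rev e).trans h.1⟩

theorem Contractible.inv {c : List K.E} (h : K.Contractible c) : K.Contractible (K.inv c) := by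
  rcases h with ⟨e, rfl⟩ | h | h
  · exact Or.inl ⟨e, by simp [PolyComplex.inv, K.rev_rev]⟩
  · exact Or.inr (Or.inr (by rwa [inv_inv]))
  · exact Or.inr (Or.inl h)

theorem Step.append_left (a : List K.E) {w w' : List K.E} (h : K.Step w w') :
    K.Step (a ++ w) (a ++ w') := by
  obtain ⟨u, c, v, hc, rfl, rfl⟩ := h
  exact ⟨a ++ u, c, v, hc, by simp, by simp⟩

theorem Step.append_right (a : List K.E) {w w' : List K.E} (h : K.Step w w') :
    K.Step (w ++ a) (w' ++ a) := by
  obtain ⟨u, c, v, hc, rfl, rfl⟩ := h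
  exact ⟨u, c, v ++ a, hc, by simp, by simp⟩

theorem Step.inv {w w' : List K.E} (h : K.Step w w') : K.Step (K.inv w) (K.inv w') := by
  obtain ⟨u, c, v, hc, rfl, rfl⟩ := h
  exact ⟨K.inv v, K.inv c, K.inv u, hc.inv, by simp [inv_append], by simp [inv_append]⟩

variable (K)

/-- Edge paths from `x` to `y`. -/
def EdgePath (x y : K.V) : Type := {w : List K.E // K.IsPath x y w}

variable {K}

/-- Concatenation of edge paths. -/
def EdgePath.trans {x y z : K.V} (p : K.EdgePath x y) (q : K.EdgePath y z) : K.EdgePath x z :=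
  ⟨p.1 ++ q.1, p.2.append q.2⟩

/-- The reversed edge path. -/
def EdgePath.symm {x y : K.V} (p : K.EdgePath x y) : K.EdgePath y x := ⟨K.inv p.1, p.2.inv⟩

variable (K)

/-- The (edge-path) fundamental group: closed edge paths at `x` modulo the equivalence relation
generated by the elementary homotopies. -/
def FundGroup (x : K.V) : Type := Quot fun p q : K.EdgePath x x => K.Step p.1 q.1

variable {K}

/-- The class of a closed edge path. -/
def toFundGroup {x : K.V} (p : K.EdgePath x x) : K.FundGroup x := Quot.mk _ p

theorem symm_trans_self {x y : K.V} (p : K.EdgePath x y) :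
    toFundGroup (p.symm.trans p) = toFundGroup ⟨[], rfl⟩ := by
  obtain ⟨w, hw⟩ := p
  induction w generalizing x with
  | nil => rfl
  | cons e w ih =>
    refine Eq.trans ?_ (ih hw.2)
    refine Quot.sound ⟨K.inv w, [K.rev e, e], w, Or.inl ⟨K.rev e, by rw [K.rev_rev]⟩, ?_, rfl⟩
    simp [EdgePath.symm, EdgePath.trans, inv_cons]

/-- The product is the concatenation of edge paths. -/
instance (x : K.V) : Group (K.FundGroup x) :=
  letI : Mul (K.FundGroup x) :=
    ⟨Quot.map₂ EdgePath.trans (fun a _ _ h => h.append_left a.1) fun _ _ b h => h.append_right b.1⟩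
  letI : One (K.FundGroup x) := ⟨toFundGroup ⟨[], rfl⟩⟩
  letI : Inv (K.FundGroup x) := ⟨Quot.map EdgePath.symm fun _ _ h => h.inv⟩
  Group.ofLeftAxioms
    (by
      rintro ⟨p⟩ ⟨q⟩ ⟨r⟩
      exact congrArg toFundGroup (Subtype.ext (List.append_assoc p.1 q.1 r.1)))
    (by rintro ⟨p⟩; rfl)
    (by rintro ⟨p⟩; exact symm_trans_self p)

variable (K)

/-- The connected components of `K`. -/
def Component : Type := Quot fun x y : K.V => Nonempty (K.EdgePath x y)

/-- `K` is connected. -/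
def IsConnected : Prop := Nonempty K.V ∧ ∀ x y : K.V, Nonempty (K.EdgePath x y)

/-- A `G`-cocycle on `K`: a labeling of the oriented edges by elements of `G` such that reversing
an edge inverts its label and the product around each 2-cell is `1`. -/
@[ext] structure Cocycle (G : Type) [Group G] where
  label : K.E → G
  label_rev : ∀ e, label (K.rev e) = (label e)⁻¹
  prod_face : ∀ w, K.Face w → (w.map label).prod = 1

variable {K}

theorem Cocycle.prod_inv {G : Type} [Group G] (σ : K.Cocycle G) (w : List K.E) :
    ((K.inv w).map σ.label).prod = ((w.map σ.label).prod)⁻¹ := by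
  induction w with
  | nil => simp [inv]
  | cons e w ih => simp [inv_cons, ih, σ.label_rev]

theorem Cocycle.prod_step {G : Type} [Group G] (σ : K.Cocycle G) {w w' : List K.E}
    (h : K.Step w w') : (w.map σ.label).prod = (w'.map σ.label).prod := by
  obtain ⟨u, c, v, hc, rfl, rfl⟩ := h
  have : (c.map σ.label).prod = 1 := by
    rcases hc with ⟨e, rfl⟩ | h | h
    · simp [σ.label_rev]
    · exact σ.prod_face _ h
    · have := σ.prod_face _ h
      rwa [σ.prod_inv, inv_eq_one] at this
  simp [this]

/-- The representation of the fundamental group determined by a cocycle: the product of the labels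
along closed edge paths. -/
def Cocycle.holonomy {G : Type} [Group G] (σ : K.Cocycle G) (x : K.V) : K.FundGroup x →* G :=
  MonoidHom.mk' (Quot.lift (fun p => (p.1.map σ.label).prod) fun _ _ h => σ.prod_step h) (by
    rintro ⟨p⟩ ⟨q⟩
    exact (congrArg List.prod List.map_append).trans List.prod_append)

end PolyComplex

/-! ## Concrete triangulations of oriented 3-manifolds -/

open Equiv in
/-- A concrete triangulation of a compact oriented 3-manifold `M`: finitely many copies of the
ordered simplex with vertices `0, 1, 2, 3`, whose faces are glued in pairs. The face of `Δ` opposite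
to the vertex `i` is glued to a face of `nbr Δ i`, and `perm Δ i` is the face pairing permutation:
a vertex `v ≠ i` of `Δ` goes to the vertex `perm Δ i v`, so that the other face is the one opposite
to `perm Δ i i`. The sign `orient Δ` compares the orientation of `M` with the one given by the
vertex order of `Δ`; `orient_nbr` says that `M` is oriented. -/
structure ConcreteTriangulation where
  Tet : Type
  fintype : Fintype Tet
  nbr : Tet → Fin 4 → Tet
  perm : Tet → Fin 4 → Perm (Fin 4)
  nbr_nbr : ∀ Δ i, nbr (nbr Δ i) (perm Δ i i) = Δ
  perm_perm : ∀ Δ i, perm (nbr Δ i) (perm Δ i i) = (perm Δ i)⁻¹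
  face_ne : ∀ Δ i, ¬ (nbr Δ i = Δ ∧ perm Δ i i = i)
  orient : Tet → ℤˣ
  orient_nbr : ∀ Δ i, orient (nbr Δ i) = -(Perm.sign (perm Δ i) * orient Δ)

namespace ConcreteTriangulation

open Equiv

variable (T : ConcreteTriangulation)

/-- The vertices of the doubly truncated simplices. The pair `(Δ, p)` is the vertex `v₀v₁v₂` of the
doubly truncated `Δ`, where `vᵢ = p i`: the vertex near the vertex `v₀`, the edge `v₀v₁` and the
face `v₀v₁v₂` of `Δ`. -/
def Flag : Type := T.Tet × Perm (Fin 4)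

variable {T}

/-- The other endpoint `v₁v₀v₂` of the long edge at `v₀v₁v₂`. -/
def Flag.long (f : T.Flag) : T.Flag := (f.1, f.2 * swap 0 1)

/-- The other endpoint `v₀v₂v₁` of the middle edge at `v₀v₁v₂`. -/
def Flag.middle (f : T.Flag) : T.Flag := (f.1, f.2 * swap 1 2)

/-- The other endpoint `v₀v₁v₃` of the short edge at `v₀v₁v₂`. -/
def Flag.short (f : T.Flag) : T.Flag := (f.1, f.2 * swap 2 3)

/-- The vertex identified with `v₀v₁v₂` under the pairing of the face `v₀v₁v₂`. -/
def Flag.glue (f : T.Flag) : T.Flag := (T.nbr f.1 (f.2 3), T.perm f.1 (f.2 3) * f.2)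

@[simp] theorem Flag.long_long (f : T.Flag) : f.long.long = f := by
  refine Prod.ext rfl ?_
  simp [Flag.long, mul_assoc]

@[simp] theorem Flag.middle_middle (f : T.Flag) : f.middle.middle = f := by
  refine Prod.ext rfl ?_
  simp [Flag.middle, mul_assoc]

@[simp] theorem Flag.short_short (f : T.Flag) : f.short.short = f := by
  refine Prod.ext rfl ?_
  simp [Flag.short, mul_assoc]

@[simp] theorem Flag.glue_glue (f : T.Flag) : f.glue.glue = f := by
  refine Prod.ext ?_ ?_
  · simp [Flag.glue, T.nbr_nbr]
  · simp [Flag.glue, T.perm_perm]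

theorem Flag.long_glue (f : T.Flag) : f.glue.long = f.long.glue := by
  have h : (f.2 * swap 0 1 : Perm (Fin 4)) 3 = f.2 3 := by
    rw [Perm.mul_apply, swap_apply_of_ne_of_ne (by decide) (by decide)]
  simp only [Flag.glue, Flag.long, mul_assoc, h]
  rfl

theorem Flag.middle_glue (f : T.Flag) : f.glue.middle = f.middle.glue := by
  have h : (f.2 * swap 1 2 : Perm (Fin 4)) 3 = f.2 3 := by
    rw [Perm.mul_apply, swap_apply_of_ne_of_ne (by decide) (by decide)]
  simp only [Flag.glue, Flag.middle, mul_assoc, h]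
  rfl

variable (T)

/-- Two vertices of doubly truncated simplices are the same point of `M`. -/
instance flagSetoid : Setoid T.Flag where
  r f g := g = f ∨ g = f.glue
  iseqv :=
    { refl := fun _ => Or.inl rfl
      symm := by
        rintro f g (rfl | rfl)
        · exact Or.inl rfl
        · exact Or.inr (Flag.glue_glue f).symm
      trans := by
        rintro f g h (rfl | rfl) (rfl | rfl)
        · exact Or.inl rfl
        · exact Or.inr rfl
        · exact Or.inr rfl
        · exact Or.inl (Flag.glue_glue f) }

/-- The vertices of the decomposition of `M` into doubly truncated simplices and prisms. -/
def Vertex : Type := Quotient T.flagSetoid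

variable {T}

/-- The point of `M` given by a vertex of a doubly truncated simplex. -/
def Flag.vertex (f : T.Flag) : T.Vertex := Quotient.mk _ f

/-- The other endpoint of the long edge at a vertex. -/
def Vertex.long : T.Vertex → T.Vertex :=
  Quotient.map Flag.long (by
    rintro f g (rfl | rfl)
    · exact Or.inl rfl
    · exact Or.inr (Flag.long_glue f))

/-- The other endpoint of the middle edge at a vertex. -/
def Vertex.middle : T.Vertex → T.Vertex :=
  Quotient.map Flag.middle (by
    rintro f g (rfl | rfl)
    · exact Or.inl rfl
    · exact Or.inr (Flag.middle_glue f))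

@[simp] theorem Vertex.long_long (v : T.Vertex) : v.long.long = v := by
  induction v using Quotient.inductionOn with
  | h f => exact congrArg Flag.vertex (Flag.long_long f)

@[simp] theorem Vertex.middle_middle (v : T.Vertex) : v.middle.middle = v := by
  induction v using Quotient.inductionOn with
  | h f => exact congrArg Flag.vertex (Flag.middle_middle f)

variable (T)

/-- The oriented edges of the decomposition of `∂M`, given by their starting vertices. Middle edges
are identified by the face pairings (one middle edge starts at each vertex of the decomposition),
short edges are not (one starts at each vertex of each doubly truncated simplex). -/
inductive BdryEdge : Type
  | middle (v : T.Vertex)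
  | short (f : T.Flag)

/-- The oriented edges of the decomposition of `M`: long edges, and the edges in `∂M`. -/
inductive Edge : Type
  | long (v : T.Vertex)
  | bdry (e : T.BdryEdge)

variable {T}

/-- The starting vertex of an edge in `∂M`. -/
def BdryEdge.src : T.BdryEdge → T.Vertex
  | .middle v => v
  | .short f => f.vertex

/-- The reversed edge of an edge in `∂M`. -/
def BdryEdge.rev : T.BdryEdge → T.BdryEdge
  | .middle v => .middle v.middle
  | .short f => .short f.short

/-- The starting vertex of an edge. -/
def Edge.src : T.Edge → T.Vertex
  | .long v => v
  | .bdry e => e.src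

/-- The reversed edge. -/
def Edge.rev : T.Edge → T.Edge
  | .long v => .long v.long
  | .bdry e => .bdry e.rev

theorem BdryEdge.rev_rev (e : T.BdryEdge) : e.rev.rev = e := by
  cases e <;> simp [BdryEdge.rev]

theorem Edge.rev_rev (e : T.Edge) : e.rev.rev = e := by
  cases e <;> simp [Edge.rev, BdryEdge.rev_rev]

/-- The rotation about the edge `v₀v₁`: from `v₀v₁v₂` through `Δ` to `v₀v₁v₃`, and across the face
`v₀v₁v₃` into the next simplex around the edge. -/
def Flag.rotate (f : T.Flag) : T.Flag := f.short.glue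

variable (T)

/-- The boundary words of the 2-cells of `∂M`. -/
inductive BdryFace : List T.BdryEdge → Prop
  /-- The hexagon of a doubly truncated simplex near a vertex of the simplex. -/
  | hexagon (f : T.Flag) : BdryFace
      [.short f, .middle f.short.vertex,
        .short f.short.middle, .middle f.short.middle.short.vertex,
        .short f.short.middle.short.middle, .middle f.short.middle.short.middle.short.vertex]
  /-- The bottom of the prism around an edge of the triangulation: the short edges met when one
  rotates once about the edge. -/
  | polygon (f : T.Flag) : BdryFace
      ((List.range (Function.minimalPeriod Flag.rotate f)).map fun j => .short (Flag.rotate^[j] f))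

/-- The boundary words of the 2-cells of `M`. -/
inductive Face : List T.Edge → Prop
  /-- A 2-cell in `∂M`. -/
  | bdry (w : List T.BdryEdge) (hw : T.BdryFace w) : Face (w.map .bdry)
  /-- The hexagon of a doubly truncated simplex in a face of the simplex. -/
  | hexagon (v : T.Vertex) : Face
      [.long v, .bdry (.middle v.long), .long v.long.middle, .bdry (.middle v.long.middle.long),
        .long v.long.middle.long.middle, .bdry (.middle v.long.middle.long.middle.long)]
  /-- The rectangle between a doubly truncated simplex and the prism around one of its edges. -/
  | rectangle (f : T.Flag) : Face
      [.long f.vertex, .bdry (.short f.long), .long f.long.short.vertex,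
        .bdry (.short f.long.short.long)]

/-- The decomposition of `∂M` induced by the decomposition of `M`. -/
abbrev boundary : PolyComplex where
  V := T.Vertex
  E := T.BdryEdge
  src := BdryEdge.src
  tgt e := e.rev.src
  rev := BdryEdge.rev
  rev_rev := BdryEdge.rev_rev
  src_rev _ := rfl
  Face := T.BdryFace

/-- The decomposition of `M` into doubly truncated simplices and prisms. -/
abbrev complex : PolyComplex where
  V := T.Vertex
  E := T.Edge
  src := Edge.src
  tgt e := e.rev.src
  rev := Edge.rev
  rev_rev := Edge.rev_rev
  src_rev _ := rfl
  Face := T.Face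

variable {T}

theorem isPath_bdry {x y : T.Vertex} {w : List T.BdryEdge} (h : T.boundary.IsPath x y w) :
    T.complex.IsPath x y (w.map .bdry) := by
  induction w generalizing x with
  | nil => exact h
  | cons e w ih => exact ⟨h.1, ih h.2⟩

/-- An edge path in `∂M`, as an edge path in `M`. -/
def incl {x y : T.Vertex} (p : T.boundary.EdgePath x y) : T.complex.EdgePath x y :=
  ⟨p.1.map .bdry, isPath_bdry p.2⟩

/-- The peripheral element of the fundamental group of `M` at `x` given by a closed edge path `l` in
`∂M` and a path from `x` to its starting point. -/
def peripheral {x y : T.Vertex} (p : T.complex.EdgePath x y) (l : T.boundary.EdgePath y y) :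
    T.complex.FundGroup x :=
  PolyComplex.toFundGroup ((p.trans (incl l)).trans p.symm)

end ConcreteTriangulation

/-! ## Subgroups of `PGL(n, ℂ)` -/

theorem diag_mul_of_upper {n : ℕ} {A B : Matrix (Fin n) (Fin n) ℂ} (hA : A.BlockTriangular id)
    (hB : B.BlockTriangular id) (i : Fin n) : (A * B) i i = A i i * B i i := by
  rw [Matrix.mul_apply]
  refine Finset.sum_eq_single i (fun k _ hk => ?_) (by simp)
  rcases lt_or_gt_of_ne hk with h | h
  · rw [hA h, zero_mul]
  · rw [hB h, mul_zero]

theorem inv_upper {n : ℕ} {A : GL (Fin n) ℂ} (hA : A.1.BlockTriangular id) :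
    (A⁻¹).1.BlockTriangular id := by
  rw [Matrix.coe_units_inv]
  have : Invertible A.1 := A.invertible
  exact Matrix.blockTriangular_inv_of_blockTriangular hA

/-- The invertible upper triangular matrices. -/
def upperGL (n : ℕ) : Subgroup (GL (Fin n) ℂ) where
  carrier := {A | A.1.BlockTriangular id}
  one_mem' := Matrix.blockTriangular_one
  mul_mem' hA hB := Matrix.BlockTriangular.mul hA hB
  inv_mem' hA := inv_upper hA

/-- The upper triangular matrices with ones on the diagonal. -/
def unipotentGL (n : ℕ) : Subgroup (GL (Fin n) ℂ) where
  carrier := {A | A.1.BlockTriangular id ∧ ∀ i, A.1 i i = 1}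
  one_mem' := ⟨Matrix.blockTriangular_one, fun i => Matrix.one_apply_eq i⟩
  mul_mem' := by
    rintro A B ⟨hA, hA'⟩ ⟨hB, hB'⟩
    exact ⟨hA.mul hB, fun i => by
      rw [Units.val_mul, diag_mul_of_upper hA hB, hA', hB', one_mul]⟩
  inv_mem' := by
    rintro A ⟨hA, hA'⟩
    refine ⟨inv_upper hA, fun i => ?_⟩
    have h : (A.1 * (A⁻¹).1) i i = 1 := by
      rw [← Units.val_mul, mul_inv_cancel, Units.val_one, Matrix.one_apply_eq]
    rwa [diag_mul_of_upper hA (inv_upper hA), hA', one_mul] at h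

/-- The subgroup `B` of `PGL(n, ℂ)`. -/
def borelPGL (n : ℕ) : Subgroup PGL(n, ℂ) := (upperGL n).map Matrix.ProjGenLinGroup.mk

/-- The subgroup `N` of `PGL(n, ℂ)`. -/
def unipotentPGL (n : ℕ) : Subgroup PGL(n, ℂ) := (unipotentGL n).map Matrix.ProjGenLinGroup.mk

/-- The coset `gB` in `PGL(n, ℂ)/B`. -/
def cosetB {n : ℕ} (g : GL (Fin n) ℂ) : PGL(n, ℂ) ⧸ borelPGL n :=
  QuotientGroup.mk (Matrix.ProjGenLinGroup.mk g)

/-- The counter-diagonal matrix with all counter-diagonal entries `1`. -/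
def counterDiag (n : ℕ) : GL (Fin n) ℂ :=
  Matrix.GeneralLinearGroup.mkOfDetNeZero ((Fin.revPerm (n := n)).permMatrix ℂ) (by
    rw [Matrix.det_permutation]
    exact_mod_cast (Equiv.Perm.sign (Fin.revPerm (n := n))).ne_zero)

/-- The normalized elements of `N⁻`: lower triangular, with ones on the diagonal and with ones in
the first column. -/
def IsNormalizedLower {n : ℕ} (A : GL (Fin n) ℂ) : Prop :=
  (∀ i j, i < j → A.1 i j = 0) ∧ (∀ i, A.1 i i = 1) ∧ ∀ i j, j.val = 0 → A.1 i j = 1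

/-! ## Ptolemy coordinates, shape parameters and `X`-coordinates of a simplex -/

section Coordinates

variable {n : ℕ} (g : Fin 4 → GL (Fin n) ℂ)

/-- The `n × n` matrix formed by the first `t 0` columns of `g 0`, then the first `t 1` columns
of `g 1`, and so on, for `t 0 + t 1 + t 2 + t 3 = n`. -/
def columns (t : Fin 4 → ℕ) : Matrix (Fin n) (Fin n) ℂ := fun i j =>
  if j.val < t 0 then (g 0).1 i j
  else if j.val < t 0 + t 1 then (g 1).1 i ⟨j - t 0, by omega⟩
  else if j.val < t 0 + t 1 + t 2 then (g 2).1 i ⟨j - (t 0 + t 1), by omega⟩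
  else (g 3).1 i ⟨j - (t 0 + t 1 + t 2), by omega⟩

/-- The Ptolemy coordinate at the integral point `t`. -/
def ptolemy (t : Fin 4 → ℕ) : ℂ := (columns g t).det

/-- The shape parameter `z_s^e` of the edge `e` of the subsimplex `s`. -/
def shape (s e : Fin 4 → ℕ) : ℂ :=
  if e = ![1, 1, 0, 0] ∨ e = ![0, 0, 1, 1] then
    ptolemy g (s + ![1, 0, 0, 1]) * ptolemy g (s + ![0, 1, 1, 0]) /
      (ptolemy g (s + ![1, 0, 1, 0]) * ptolemy g (s + ![0, 1, 0, 1]))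
  else if e = ![0, 1, 1, 0] ∨ e = ![1, 0, 0, 1] then
    ptolemy g (s + ![0, 1, 0, 1]) * ptolemy g (s + ![1, 0, 1, 0]) /
      (ptolemy g (s + ![1, 1, 0, 0]) * ptolemy g (s + ![0, 0, 1, 1]))
  else if e = ![1, 0, 1, 0] ∨ e = ![0, 1, 0, 1] then
    -(ptolemy g (s + ![1, 1, 0, 0]) * ptolemy g (s + ![0, 0, 1, 1]) /
      (ptolemy g (s + ![1, 0, 0, 1]) * ptolemy g (s + ![0, 1, 1, 0])))
  else 0

/-- The six edges of a (sub)simplex. -/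
def simplexEdges : Finset (Fin 4 → ℕ) :=
  {![1, 1, 0, 0], ![1, 0, 1, 0], ![1, 0, 0, 1], ![0, 1, 1, 0], ![0, 1, 0, 1], ![0, 0, 1, 1]}

/-- The `X`-coordinate at the face point `t`: minus the product of the `z_s^e` with `s + e = t`. -/
def xCoord (t : Fin 4 → ℕ) : ℂ := -∏ e ∈ simplexEdges with ∀ i, e i ≤ t i, shape g (t - e) e

end Coordinates

/-! ## Decorations, natural cocycles and cusp equations -/

namespace ConcreteTriangulation

open Equiv

variable (T : ConcreteTriangulation) (n : ℕ)

/-- A `PGL(n, ℂ)/B`-decoration: a coset, given by the representative `rep Δ v`, at each vertex `v`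
of each simplex `Δ`, such that the cosets on two identified faces differ by left multiplication by
a unique element. -/
structure Decoration where
  rep : T.Tet → Fin 4 → GL (Fin n) ℂ
  compat : ∀ Δ i, ∃! g : PGL(n, ℂ), ∀ v, v ≠ i →
    g • cosetB (rep Δ v) = cosetB (rep (T.nbr Δ i) (T.perm Δ i v))

variable {T n}

/-- Genericity: all Ptolemy determinants are nonzero. -/
def Decoration.IsGeneric (D : T.Decoration n) : Prop :=
  ∀ Δ, ∀ t : Fin 4 → ℕ, ∑ i, t i = n → ptolemy (D.rep Δ) t ≠ 0

/-- `σ` is the natural `(PGL(n, ℂ), B, H)`-cocycle of `D`: on each doubly truncated simplex it is the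
coboundary of the 0-cochain `τ` with `(g_{v₀}B, g_{v₁}B, g_{v₂}B) = τ^{v₀v₁v₂}(B, q₁B, mB)`, where
`m` is a normalized element of `N⁻`. -/
def IsNaturalCocycle (D : T.Decoration n) (σ : T.complex.Cocycle PGL(n, ℂ)) : Prop :=
  ∀ Δ : T.Tet, ∃ τ : Perm (Fin 4) → PGL(n, ℂ),
    (∀ p, ∃ m : GL (Fin n) ℂ, IsNormalizedLower m ∧
      cosetB (D.rep Δ (p 0)) = τ p • cosetB 1 ∧
      cosetB (D.rep Δ (p 1)) = τ p • cosetB (counterDiag n) ∧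
      cosetB (D.rep Δ (p 2)) = τ p • cosetB m) ∧
    ∀ p, σ.label (Edge.long (Flag.vertex (Δ, p))) = (τ p)⁻¹ * τ (p * swap 0 1) ∧
      σ.label (Edge.bdry (.middle (Flag.vertex (Δ, p)))) = (τ p)⁻¹ * τ (p * swap 1 2) ∧
      σ.label (Edge.bdry (.short (Δ, p))) = (τ p)⁻¹ * τ (p * swap 2 3)

/-- `L` is the canonical lift to `GL(n, ℂ)` of the restriction of `σ` to `∂M`: it labels middle edges
by upper triangular matrices whose last column consists of ones, and short edges by diagonal
matrices whose last diagonal entry is one. -/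
def IsCanonicalLift (σ : T.complex.Cocycle PGL(n, ℂ)) (L : T.boundary.Cocycle (GL (Fin n) ℂ)) :
    Prop :=
  (∀ e : T.BdryEdge, Matrix.ProjGenLinGroup.mk (L.label e) = σ.label (Edge.bdry e)) ∧
  (∀ v : T.Vertex, (L.label (BdryEdge.middle v)).1.BlockTriangular id ∧
    ∀ i j : Fin n, j.val + 1 = n → (L.label (BdryEdge.middle v)).1 i j = 1) ∧
  ∀ f : T.Flag, (L.label (BdryEdge.short f)).1.IsDiag ∧
    ∀ i : Fin n, i.val + 1 = n → (L.label (BdryEdge.short f)).1 i i = 1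

/-- The `l`-th diagonal entry, `1 ≤ l ≤ n`. -/
def diagEntry (A : GL (Fin n) ℂ) (l : ℕ) : ℂ :=
  if h : 1 ≤ l ∧ l ≤ n then A.1 ⟨l - 1, by omega⟩ ⟨l - 1, by omega⟩ else 0

/-- The level `l` cusp equation of an edge path in `∂M`. -/
def CuspEquation (L : T.boundary.Cocycle (GL (Fin n) ℂ)) {x y : T.Vertex}
    (p : T.boundary.EdgePath x y) (l : ℕ) : Prop :=
  (p.1.map fun e => diagEntry (L.label e) l).prod = 1

/-- The level `l` cusp equation in terms of quotients of consecutive diagonal entries. -/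
def RatioCuspEquation (L : T.boundary.Cocycle (GL (Fin n) ℂ)) {x y : T.Vertex}
    (p : T.boundary.EdgePath x y) (l : ℕ) : Prop :=
  (p.1.map fun e => diagEntry (L.label e) l / diagEntry (L.label e) (l + 1)).prod = 1

/-- The level `l` contribution of the middle edge starting at `v₀v₁v₂` in the simplex `Δ`: minus the
product of the `X_t^ε` over `t = k v₂ + l v₀ + (n - k - l) v₁`, `1 ≤ k ≤ n - 1 - l`, where the sign
`ε` is `1` if and only if `v₀v₁v₂` is an even reordering of `012`. -/
def middleTerm (D : T.Decoration n) (f : T.Flag) (l : ℕ) : ℂ :=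
  -∏ k ∈ Finset.Icc 1 (n - 1 - l),
    xCoord (D.rep f.1)
      (Pi.single (f.2 2) k + Pi.single (f.2 0) l + Pi.single (f.2 1) (n - k - l)) ^
      (Perm.sign f.2 : ℤ)

/-- The level `l` contribution of the short edge starting at `v₀v₁v₂` in the simplex `Δ`: the shape
parameter `z_s^e` with `s = (l - 1) v₀ + (n - 1 - l) v₁` and `e = v₀ + v₁`, to the power `-ε`. -/
def shortTerm (D : T.Decoration n) (f : T.Flag) (l : ℕ) : ℂ :=
  shape (D.rep f.1) (Pi.single (f.2 0) (l - 1) + Pi.single (f.2 1) (n - 1 - l))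
    (Pi.single (f.2 0) 1 + Pi.single (f.2 1) 1) ^ (-(Perm.sign f.2 : ℤ))

/-- The level `l` contribution of an edge in `∂M`. For middle edges, which lie in two simplices,
`r` chooses the simplex. -/
def edgeTerm (D : T.Decoration n) (r : T.Vertex → T.Flag) (l : ℕ) : T.BdryEdge → ℂ
  | .middle v => middleTerm D (r v) l
  | .short f => shortTerm D f l

/-- The level `l` cusp equation in terms of `X`-coordinates and shape parameters. -/
def ShapeCuspEquation (D : T.Decoration n) (r : T.Vertex → T.Flag) {x y : T.Vertex}
    (p : T.boundary.EdgePath x y) (l : ℕ) : Prop :=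
  (p.1.map (edgeTerm D r l)).prod = 1

/-- `ρ` is boundary-unipotent: it takes every peripheral curve to a conjugate of an element of
`N`. -/
def IsBoundaryUnipotent {x : T.Vertex} (ρ : T.complex.FundGroup x →* PGL(n, ℂ)) : Prop :=
  ∀ (y : T.Vertex) (p : T.complex.EdgePath x y) (l : T.boundary.EdgePath y y),
    ∃ g : PGL(n, ℂ), ∃ u ∈ unipotentPGL n, ρ (peripheral p l) = g * u * g⁻¹

/-- `ρ` takes every peripheral subgroup into a conjugate of `N`. -/
def IsPeripherallyUnipotent {x : T.Vertex} (ρ : T.complex.FundGroup x →* PGL(n, ℂ)) : Prop :=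
  ∀ (y : T.Vertex) (p : T.complex.EdgePath x y), ∃ g : PGL(n, ℂ),
    ∀ l : T.boundary.EdgePath y y, ∃ u ∈ unipotentPGL n, ρ (peripheral p l) = g * u * g⁻¹

end ConcreteTriangulation

end

/-! Everything happens in adapted frames: lifts `τ` to GL of the 0-cochain defining the natural
cocycle. Boundary labels are `τ⁻¹ * τ'` up to scalars. A middle edge joins two frames with the same
first flag, so its label is upper triangular. The first vector of the third flag has equal
coordinates in `τ` and spans the last column of `τ'`, so the last column of the label is constant. A
short edge joins frames sharing two opposite flags, so its label is diagonal. Rescaling puts each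
label in `cornerOneGL`, on which `mk` is injective (`eq_of_mk_eq_of_mem_cornerOneGL`). Hence all
cocycle identities lift from PGL to GL, and the lift is unique.

For the diagonal entries, insert a vector between the first `i` columns of `g 0` and the first `n -
1 - i` columns of `g 1` and take the determinant. This functional, `splitDet`, is a multiple of the
`i`-th coordinate in the frame, and the multiple is found by inserting the first vector of the third
flag. Comparing two frames expresses each diagonal entry by Ptolemy coordinates, up to a factor
independent of `i` and, for middle edges, a sign alternating with `i` (`IsFrame.short_entry`,
`IsFrame.middle_entry`). Consecutive quotients give an inverse shape parameter on short edges. On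
middle edges they give a telescoping product of `X`-coordinates (`prod_xCoord_face`), with the minus
sign coming from the alternating sign. Other vertex orders reduce to the standard one because a
permutation raises shapes and `X`-coordinates to its sign (`shape_comp`, `xCoord_comp`).

For unipotency, diagonal entries multiply along products of triangular matrices, so the cusp
equations of a loop say that its lifted label product is unipotent. Since the last entry is 1, this
can already be detected up to scalar and conjugation, by the characteristic polynomial
(`mem_unipotentGL_of_mk_eq_conj`). Generators suffice because the unipotent matrices form a group,
and base points can be moved because that group is normalized by the triangular one. -/

/-! ## Ptolemy coordinates under permutations of the vertices -/

section PermuteVertices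

open Equiv

/-- Moving a block of `b` consecutive columns across the `a` columns before it multiplies the
determinant by `(-1) ^ (a * b)`. -/
theorem det_submatrix_blockSwap {n : ℕ} (M : Matrix (Fin n) (Fin n) ℂ) (o a b : ℕ)
    (f : Fin n → Fin n)
    (hf : ∀ j : Fin n, (f j).val = if j.val < o then j.val else if j.val < o + b then j.val + a else
      if j.val < o + b + a then j.val - b else j.val) (h : o + a + b ≤ n) :
    (M.submatrix id f).det = (-1) ^ (a * b) * M.det := by
  induction a generalizing f M with
  | zero =>
    have : f = id := by
      funext j
      apply Fin.ext
      rw [hf, id]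
      split_ifs <;> omega
    simp [this]
  | succ a ih =>
    rcases Nat.eq_zero_or_pos n with rfl | hn
    · omega
    have : NeZero n := ⟨hn.ne'⟩
    -- The cycle carries only the last of the `a + 1` columns past the block of length `b`,
    -- contributing `(-1) ^ b`; the induction hypothesis moves the block across the other `a`.
    let c : Perm (Fin n) := Fin.cycleIcc ⟨o + a, by omega⟩ ⟨o + a + b, by omega⟩
    have hc : ∀ j : Fin n, (c j).val = if j.val < o + a then j.val else
        if j.val < o + a + b then j.val + 1 else if j.val = o + a + b then o + a else j.val := by
      intro j
      split_ifs with h1 h2 h3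
      · exact congrArg Fin.val (Fin.cycleIcc_of_lt (Fin.lt_def.2 h1))
      · rw [Fin.cycleIcc_of_ge_of_lt (Fin.le_def.2 (by simpa using h1)) (Fin.lt_def.2 h2),
          Fin.val_add_one_of_lt' (by omega)]
      · have : j = ⟨o + a + b, by omega⟩ := Fin.ext h3
        rw [this, Fin.cycleIcc_of_last (Fin.le_def.2 (by simp))]
      · exact congrArg Fin.val (Fin.cycleIcc_of_gt (Fin.lt_def.2 (by simp; omega)))
    have hb : ∀ j : Fin n, (if j.val < o then j.val else if j.val < o + b then j.val + a else
      if j.val < o + b + a then j.val - b else j.val) < n := by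
      intro j
      split_ifs <;> omega
    have key := ih (M.submatrix id c) (fun j => ⟨_, hb j⟩) (fun _ => rfl) (by omega)
    have hfc : f = c ∘ fun j => ⟨_, hb j⟩ := by
      funext j
      apply Fin.ext
      rw [Function.comp_apply, hc, hf]
      dsimp only
      split_ifs <;> omega
    rw [Matrix.submatrix_submatrix, Function.comp_id, ← hfc, Matrix.det_permute',
      Fin.sign_cycleIcc_of_le (Fin.le_def.2 (by simp))] at key
    rw [key]
    simp only [Nat.add_sub_cancel_left]
    push_cast
    ring

variable {n : ℕ}

/-- The columns of `columns g t` that come from `g a`. -/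
theorem columns_apply (g : Fin 4 → GL (Fin n) ℂ) (t : Fin 4 → ℕ) (a : Fin 4) (i j k : Fin n)
    (hk : k.val < t a) (hj : j.val = ![0, t 0, t 0 + t 1, t 0 + t 1 + t 2] a + k.val) :
    columns g t i j = (g a).1 i k := by
  match a with
  | 0 =>
    simp only [Matrix.cons_val] at hj
    rw [columns, if_pos (by omega)]
    exact congrArg ((g 0).1 i) (Fin.ext (by omega))
  | 1 =>
    simp only [Matrix.cons_val] at hj
    rw [columns, if_neg (by omega), if_pos (by omega)]
    exact congrArg ((g 1).1 i) (Fin.ext (by simp only; omega))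
  | 2 =>
    simp only [Matrix.cons_val] at hj
    rw [columns, if_neg (by omega), if_neg (by omega), if_pos (by omega)]
    exact congrArg ((g 2).1 i) (Fin.ext (by simp only; omega))
  | 3 =>
    simp only [Matrix.cons_val] at hj
    rw [columns, if_neg (by omega), if_neg (by omega), if_neg (by omega)]
    exact congrArg ((g 3).1 i) (Fin.ext (by simp only; omega))

theorem exists_column (t : Fin 4 → ℕ) (ht : ∑ i, t i = n) (j : Fin n) :
    ∃ (a : Fin 4) (k : Fin n), k.val < t a ∧
      j.val = ![0, t 0, t 0 + t 1, t 0 + t 1 + t 2] a + k.val := by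
  rw [Fin.sum_univ_four] at ht
  have := j.2
  by_cases h0 : j.val < t 0
  · exact ⟨0, ⟨j, by omega⟩, by simpa using h0, by simp⟩
  by_cases h1 : j.val < t 0 + t 1
  · exact ⟨1, ⟨j - t 0, by omega⟩, by simp only; omega, by simp; omega⟩
  by_cases h2 : j.val < t 0 + t 1 + t 2
  · exact ⟨2, ⟨j - (t 0 + t 1), by omega⟩, by simp only; omega, by simp; omega⟩
  · exact ⟨3, ⟨j - (t 0 + t 1 + t 2), by omega⟩, by simp only; omega, by simp; omega⟩

/-- Ptolemy coordinates under the exchange of two consecutive vertices. -/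
theorem ptolemy_swap (g : Fin 4 → GL (Fin n) ℂ) (t : Fin 4 → ℕ) (ht : ∑ i, t i = n) (k : Fin 3) :
    ptolemy (g ∘ swap k.castSucc k.succ) (t ∘ swap k.castSucc k.succ) =
      (-1) ^ (t k.castSucc * t k.succ) * ptolemy g t := by
  have hs := ht
  rw [Fin.sum_univ_four] at hs
  -- Here `o` counts the columns in front of the two exchanged blocks. What remains for each
  -- transposition is a comparison of column offsets.
  have h : ∀ (σ : Perm (Fin 4)) (c d : Fin 4) (o : ℕ), o + t c + t d ≤ n →
      (∀ a m j, m < t (σ a) →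
        j = ![0, t (σ 0), t (σ 0) + t (σ 1), t (σ 0) + t (σ 1) + t (σ 2)] a + m →
        ![0, t 0, t 0 + t 1, t 0 + t 1 + t 2] (σ a) + m =
        if j < o then j else if j < o + t d then j + t c else if j < o + t d + t c then j - t d
          else j) →
      ptolemy (g ∘ σ) (t ∘ σ) = (-1) ^ (t c * t d) * ptolemy g t := by
    intro σ c d o ho h
    have hb : ∀ j : Fin n, (if j.val < o then j.val else if j.val < o + t d then j.val + t c else
        if j.val < o + t d + t c then j.val - t d else j.val) < n := by
      intro j
      split_ifs <;> omega
    rw [ptolemy, ptolemy, ← det_submatrix_blockSwap _ o (t c) (t d) (fun j => ⟨_, hb j⟩)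
      (fun _ => rfl) ho]
    congr 1
    ext i j
    obtain ⟨a, m, hm, hj⟩ := exists_column (t ∘ σ)
      ((Equiv.sum_comp σ t).trans ht) j
    rw [columns_apply _ _ a i j m hm hj, Matrix.submatrix_apply,
      columns_apply g t (σ a) _ _ m hm]
    · rfl
    · exact (h a m j hm hj).symm
  match k with
  | 0 =>
    refine h (swap 0 1) 0 1 0 (by omega) fun a m j hm hj => ?_
    have e : (⇑(swap (0 : Fin 4) 1)) = ![1, 0, 2, 3] := by decide
    simp only [e] at hm hj ⊢
    match a with
    | 0 | 1 | 2 | 3 =>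
      simp only [Matrix.cons_val] at hm hj ⊢
      split_ifs <;> omega
  | 1 =>
    refine h (swap 1 2) 1 2 (t 0) (by omega) fun a m j hm hj => ?_
    have e : (⇑(swap (1 : Fin 4) 2)) = ![0, 2, 1, 3] := by decide
    simp only [e] at hm hj ⊢
    match a with
    | 0 | 1 | 2 | 3 =>
      simp only [Matrix.cons_val] at hm hj ⊢
      split_ifs <;> omega
  | 2 =>
    refine h (swap 2 3) 2 3 (t 0 + t 1) (by omega) fun a m j hm hj => ?_
    have e : (⇑(swap (2 : Fin 4) 3)) = ![0, 1, 3, 2] := by decide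
    simp only [e] at hm hj ⊢
    match a with
    | 0 | 1 | 2 | 3 =>
      simp only [Matrix.cons_val] at hm hj ⊢
      split_ifs <;> omega

end PermuteVertices

/-! ### Shape parameters and `X`-coordinates under permutations of the vertices. -/

section PermuteShapes

open Equiv

variable {n : ℕ}

/-- The product of the Ptolemy coordinates at the two opposite edge points `s + e` and
`s + (1 - e)` of the subsimplex `s`. -/
noncomputable def oppositeProd (g : Fin 4 → GL (Fin n) ℂ) (s e : Fin 4 → ℕ) : ℂ :=
  ptolemy g (s + e) * ptolemy g (s + (1 - e))

theorem sum_of_mem_simplexEdges {e : Fin 4 → ℕ} (he : e ∈ simplexEdges) : ∑ i, e i = 2 := by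
  simp only [simplexEdges, Finset.mem_insert, Finset.mem_singleton] at he
  rcases he with rfl | rfl | rfl | rfl | rfl | rfl <;> rfl

theorem one_sub_mem_simplexEdges {e : Fin 4 → ℕ} (he : e ∈ simplexEdges) :
    1 - e ∈ simplexEdges := by
  simp only [simplexEdges, Finset.mem_insert, Finset.mem_singleton] at he
  rcases he with rfl | rfl | rfl | rfl | rfl | rfl <;> decide

theorem le_one_of_mem_simplexEdges {e : Fin 4 → ℕ} (he : e ∈ simplexEdges) (i : Fin 4) :
    e i ≤ 1 := by
  simp only [simplexEdges, Finset.mem_insert, Finset.mem_singleton] at he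
  rcases he with rfl | rfl | rfl | rfl | rfl | rfl <;> revert i <;> decide

theorem comp_mem_simplexEdges (σ : Perm (Fin 4)) {e : Fin 4 → ℕ} (he : e ∈ simplexEdges) :
    e ∘ σ ∈ simplexEdges := by
  have h : ∀ e : Fin 4 → ℕ, e ∈ simplexEdges ↔ (∀ i, e i ≤ 1) ∧ ∑ i, e i = 2 := by
    refine fun e => ⟨fun he => ⟨le_one_of_mem_simplexEdges he, sum_of_mem_simplexEdges he⟩, ?_⟩
    rintro ⟨h, h2⟩
    have he : e = ![e 0, e 1, e 2, e 3] := by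
      funext i
      fin_cases i <;> rfl
    have h0 := h 0
    have h1 := h 1
    have h2' := h 2
    have h3 := h 3
    rw [Fin.sum_univ_four] at h2
    rw [he]
    generalize e 0 = a at *
    generalize e 1 = b at *
    generalize e 2 = c at *
    generalize e 3 = d at *
    clear h he
    interval_cases a <;> interval_cases b <;> interval_cases c <;> interval_cases d <;>
      first | omega | decide
  rw [h] at he ⊢
  exact ⟨fun i => he.1 _, (Equiv.sum_comp σ e).trans he.2⟩

theorem oppositeProd_one_sub (g : Fin 4 → GL (Fin n) ℂ) (s : Fin 4 → ℕ) {e : Fin 4 → ℕ}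
    (he : e ∈ simplexEdges) : oppositeProd g s (1 - e) = oppositeProd g s e := by
  have : 1 - (1 - e) = e := tsub_tsub_cancel_of_le (le_one_of_mem_simplexEdges he)
  rw [oppositeProd, oppositeProd, this, mul_comm]

/-- The two exchange signs have exponents adding up, mod 2, to `s k + s (k+1)` plus 1 exactly when
`e` takes equal values at the exchanged vertices. The part depending on `s` is common to all `e` and
cancels in shape parameters. -/
theorem oppositeProd_swap (g : Fin 4 → GL (Fin n) ℂ) (s e : Fin 4 → ℕ) (hs : ∑ i, s i + 2 = n)
    (he : e ∈ simplexEdges) (k : Fin 3) :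
    oppositeProd (g ∘ swap k.castSucc k.succ) (s ∘ swap k.castSucc k.succ)
        (e ∘ swap k.castSucc k.succ) =
      (if e k.castSucc = e k.succ then -1 else 1) * (-1) ^ (s k.castSucc + s k.succ) *
        oppositeProd g s e := by
  have hsum : ∀ e ∈ simplexEdges, ∑ i, (s + e) i = n := by
    intro e he
    simp only [Pi.add_apply, Finset.sum_add_distrib]
    rw [sum_of_mem_simplexEdges he, hs]
  have h1 := ptolemy_swap g (s + e) (hsum e he) k
  have h2 := ptolemy_swap g (s + (1 - e)) (hsum _ (one_sub_mem_simplexEdges he)) k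
  have ha := le_one_of_mem_simplexEdges he k.castSucc
  have hb := le_one_of_mem_simplexEdges he k.succ
  rw [oppositeProd, oppositeProd]
  refine (congrArg₂ (· * ·) h1 h2).trans ?_
  simp only [Pi.add_apply, Pi.sub_apply, Pi.one_apply]
  generalize e k.castSucc = a at *
  generalize e k.succ = b at *
  generalize s k.castSucc = p at *
  generalize s k.succ = q at *
  have hpq : ((-1 : ℂ) ^ (p * q)) * (-1) ^ (p * q) = 1 := by
    rw [← mul_pow]
    simp
  interval_cases a <;> interval_cases b <;> simp [pow_add, add_mul, mul_add] <;>
    linear_combination (ptolemy g (s + e) * ptolemy g (s + (1 - e)) * (-1) ^ p * (-1) ^ q) * hpq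

theorem shape_one_sub (g : Fin 4 → GL (Fin n) ℂ) (s : Fin 4 → ℕ) {e : Fin 4 → ℕ}
    (he : e ∈ simplexEdges) : shape g s (1 - e) = shape g s e := by
  simp only [simplexEdges, Finset.mem_insert, Finset.mem_singleton] at he
  rcases he with rfl | rfl | rfl | rfl | rfl | rfl <;> rfl

theorem shape_1100 (g : Fin 4 → GL (Fin n) ℂ) (s : Fin 4 → ℕ) :
    shape g s ![1, 1, 0, 0] =
      oppositeProd g s ![1, 0, 0, 1] / oppositeProd g s ![1, 0, 1, 0] := rfl

theorem shape_0110 (g : Fin 4 → GL (Fin n) ℂ) (s : Fin 4 → ℕ) :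
    shape g s ![0, 1, 1, 0] =
      oppositeProd g s ![1, 0, 1, 0] / oppositeProd g s ![1, 1, 0, 0] := by
  rw [oppositeProd, mul_comm]
  rfl

theorem shape_1010 (g : Fin 4 → GL (Fin n) ℂ) (s : Fin 4 → ℕ) :
    shape g s ![1, 0, 1, 0] =
      -(oppositeProd g s ![1, 1, 0, 0] / oppositeProd g s ![1, 0, 0, 1]) := rfl

/-- An adjacent transposition fixes one of the three pairs of opposite edges, whose product acquires
an extra minus sign, and interchanges the other two. This sign matches the one minus sign in the
definition of the shapes, so all three are inverted. -/
theorem shape_swap (g : Fin 4 → GL (Fin n) ℂ) (s e : Fin 4 → ℕ) (hs : ∑ i, s i + 2 = n)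
    (he : e ∈ simplexEdges) (k : Fin 3) :
    shape (g ∘ swap k.castSucc k.succ) (s ∘ swap k.castSucc k.succ)
        (e ∘ swap k.castSucc k.succ) = (shape g s e)⁻¹ := by
  have hc : ∀ e ∈ simplexEdges,
      e ∉ ({![1, 1, 0, 0], ![0, 1, 1, 0], ![1, 0, 1, 0]} : Finset (Fin 4 → ℕ)) →
      1 - e ∈ ({![1, 1, 0, 0], ![0, 1, 1, 0], ![1, 0, 1, 0]} : Finset (Fin 4 → ℕ)) := by
    decide
  -- Opposite edges carry the same parameter, so one representative of each pair is enough.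
  wlog h : e ∈ ({![1, 1, 0, 0], ![0, 1, 1, 0], ![1, 0, 1, 0]} : Finset (Fin 4 → ℕ)) generalizing e
  · rw [← shape_one_sub g s he, ← this (1 - e) (one_sub_mem_simplexEdges he) (hc e he h),
      ← shape_one_sub _ _ (comp_mem_simplexEdges _ he)]
    rfl
  have A1 := oppositeProd_swap g s ![1, 1, 0, 0] hs (by decide) k
  have A2 := oppositeProd_swap g s ![1, 0, 1, 0] hs (by decide) k
  have A3 := oppositeProd_swap g s ![1, 0, 0, 1] hs (by decide) k
  have N2 : ∀ g : Fin 4 → GL (Fin n) ℂ, ∀ s,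
    oppositeProd g s ![0, 1, 0, 1] = oppositeProd g s ![1, 0, 1, 0] :=
    fun g s => oppositeProd_one_sub g s (by decide : ![1, 0, 1, 0] ∈ simplexEdges)
  have N3 : ∀ g : Fin 4 → GL (Fin n) ℂ, ∀ s,
    oppositeProd g s ![0, 1, 1, 0] = oppositeProd g s ![1, 0, 0, 1] :=
    fun g s => oppositeProd_one_sub g s (by decide : ![1, 0, 0, 1] ∈ simplexEdges)
  have S3 : ∀ g : Fin 4 → GL (Fin n) ℂ, ∀ s,
    shape g s ![1, 0, 0, 1] = shape g s ![0, 1, 1, 0] :=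
    fun g s => shape_one_sub g s (by decide : ![0, 1, 1, 0] ∈ simplexEdges)
  have S2 : ∀ g : Fin 4 → GL (Fin n) ℂ, ∀ s,
    shape g s ![0, 1, 0, 1] = shape g s ![1, 0, 1, 0] :=
    fun g s => shape_one_sub g s (by decide : ![1, 0, 1, 0] ∈ simplexEdges)
  have hδ : (-1 : ℂ) ^ (s k.castSucc + s k.succ) ≠ 0 := pow_ne_zero _ (by simp)
  generalize (-1 : ℂ) ^ (s k.castSucc + s k.succ) = δ at *
  simp only [Finset.mem_insert, Finset.mem_singleton] at h
  match k with
  | 0 =>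
    change oppositeProd (g ∘ swap 0 1) (s ∘ swap 0 1) _ = _ at A1 A2 A3
    change shape (g ∘ swap 0 1) (s ∘ swap 0 1) (e ∘ swap 0 1) = _
    have e1 : (![1, 1, 0, 0] : Fin 4 → ℕ) ∘ swap (0 : Fin 4) 1 = ![1, 1, 0, 0] := by decide
    have e2 : (![1, 0, 1, 0] : Fin 4 → ℕ) ∘ swap (0 : Fin 4) 1 = ![0, 1, 1, 0] := by decide
    have e3 : (![1, 0, 0, 1] : Fin 4 → ℕ) ∘ swap (0 : Fin 4) 1 = ![0, 1, 0, 1] := by decide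
    have e4 : (![0, 1, 1, 0] : Fin 4 → ℕ) ∘ swap (0 : Fin 4) 1 = ![1, 0, 1, 0] := by decide
    rw [show Fin.castSucc (0 : Fin 3) = 0 from rfl, show Fin.succ (0 : Fin 3) = 1 from rfl]
      at A1 A2 A3
    rw [e1] at A1
    rw [e2, N3] at A2
    rw [e3, N2] at A3
    rcases h with rfl | rfl | rfl
    · rw [e1, shape_1100, shape_1100, A2, A3]
      simp [hδ, mul_div_mul_left]
    · rw [e4, shape_0110, shape_1010, A1, A2]
      simp [hδ, mul_div_mul_left, neg_div]
    · rw [e2, shape_0110, shape_1010, A1, A3]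
      simp [hδ, mul_div_mul_left, div_neg, inv_neg]
  | 1 =>
    change oppositeProd (g ∘ swap 1 2) (s ∘ swap 1 2) _ = _ at A1 A2 A3
    change shape (g ∘ swap 1 2) (s ∘ swap 1 2) (e ∘ swap 1 2) = _
    have e1 : (![1, 1, 0, 0] : Fin 4 → ℕ) ∘ swap (1 : Fin 4) 2 = ![1, 0, 1, 0] := by decide
    have e2 : (![1, 0, 1, 0] : Fin 4 → ℕ) ∘ swap (1 : Fin 4) 2 = ![1, 1, 0, 0] := by decide
    have e3 : (![1, 0, 0, 1] : Fin 4 → ℕ) ∘ swap (1 : Fin 4) 2 = ![1, 0, 0, 1] := by decide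
    have e4 : (![0, 1, 1, 0] : Fin 4 → ℕ) ∘ swap (1 : Fin 4) 2 = ![0, 1, 1, 0] := by decide
    rw [show Fin.castSucc (1 : Fin 3) = 1 from rfl, show Fin.succ (1 : Fin 3) = 2 from rfl]
      at A1 A2 A3
    rw [e1] at A1
    rw [e2] at A2
    rw [e3] at A3
    rcases h with rfl | rfl | rfl
    · rw [e1, shape_1010, shape_1100, A2, A3]
      simp [hδ, mul_div_mul_left, div_neg]
    · rw [e4, shape_0110, shape_0110, A1, A2]
      simp [hδ, mul_div_mul_left]
    · rw [e2, shape_1100, shape_1010, A1, A3]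
      simp [hδ, mul_div_mul_left, neg_div, inv_neg]
  | 2 =>
    change oppositeProd (g ∘ swap 2 3) (s ∘ swap 2 3) _ = _ at A1 A2 A3
    change shape (g ∘ swap 2 3) (s ∘ swap 2 3) (e ∘ swap 2 3) = _
    have e1 : (![1, 1, 0, 0] : Fin 4 → ℕ) ∘ swap (2 : Fin 4) 3 = ![1, 1, 0, 0] := by decide
    have e2 : (![1, 0, 1, 0] : Fin 4 → ℕ) ∘ swap (2 : Fin 4) 3 = ![1, 0, 0, 1] := by decide
    have e3 : (![1, 0, 0, 1] : Fin 4 → ℕ) ∘ swap (2 : Fin 4) 3 = ![1, 0, 1, 0] := by decide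
    have e4 : (![0, 1, 1, 0] : Fin 4 → ℕ) ∘ swap (2 : Fin 4) 3 = ![0, 1, 0, 1] := by decide
    rw [show Fin.castSucc (2 : Fin 3) = 2 from rfl, show Fin.succ (2 : Fin 3) = 3 from rfl]
      at A1 A2 A3
    rw [e1] at A1
    rw [e2] at A2
    rw [e3] at A3
    rcases h with rfl | rfl | rfl
    · rw [e1, shape_1100, shape_1100, A2, A3]
      simp [hδ, mul_div_mul_left]
    · rw [e4, S2, shape_0110, shape_1010, A1, A2]
      simp [hδ, mul_div_mul_left, neg_div]
    · rw [e2, S3, shape_0110, shape_1010, A1, A3]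
      simp [hδ, mul_div_mul_left, div_neg, inv_neg]

/-- Adjacent transpositions generate the symmetric group as a monoid, and each has sign `-1`. -/
theorem perm_induction_adjacent {p : Perm (Fin 4) → Prop} (one : p 1)
    (mul : ∀ σ k, p σ → p (σ * swap (Fin.castSucc k) k.succ)) (σ : Perm (Fin 4)) : p σ := by
  have h : σ ∈ Submonoid.closure (Set.range fun i : Fin 3 => swap i.castSucc i.succ) := by
    rw [Perm.mclosure_swap_castSucc_succ]
    trivial
  induction h using Submonoid.closure_induction_right with
  | one => exact one
  | mul_right σ hσ τ hτ ih =>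
    obtain ⟨k, rfl⟩ := hτ
    exact mul σ k ih

theorem ptolemy_comp_ne_zero_iff (g : Fin 4 → GL (Fin n) ℂ) (t : Fin 4 → ℕ) (ht : ∑ i, t i = n)
    (σ : Perm (Fin 4)) : ptolemy (g ∘ σ) (t ∘ σ) ≠ 0 ↔ ptolemy g t ≠ 0 := by
  induction σ using perm_induction_adjacent with
  | one => rfl
  | mul σ k ih =>
    rw [Perm.coe_mul, ← Function.comp_assoc, ← Function.comp_assoc,
      ptolemy_swap _ (t ∘ σ) ((Equiv.sum_comp σ t).trans ht), ← ih]
    simp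

theorem sign_swap_adjacent (k : Fin 3) : Perm.sign (swap k.castSucc k.succ) = -1 :=
  Perm.sign_swap k.castSucc_lt_succ.ne

/-- An odd reordering of the vertices inverts the shape parameters. -/
theorem shape_comp (g : Fin 4 → GL (Fin n) ℂ) (s e : Fin 4 → ℕ) (hs : ∑ i, s i + 2 = n)
    (he : e ∈ simplexEdges) (σ : Perm (Fin 4)) :
    shape (g ∘ σ) (s ∘ σ) (e ∘ σ) = shape g s e ^ (Perm.sign σ : ℤ) := by
  induction σ using perm_induction_adjacent with
  | one => simp
  | mul σ k ih =>
    rw [Perm.coe_mul, ← Function.comp_assoc, ← Function.comp_assoc, ← Function.comp_assoc,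
      shape_swap _ (s ∘ σ) _ ((congrArg (· + 2) (Equiv.sum_comp σ s)).trans hs)
        (comp_mem_simplexEdges σ he), ih, Perm.sign_mul, sign_swap_adjacent]
    simp

/-- The exponents `±1` are odd, so the sign in front of an `X`-coordinate survives inversion. -/
theorem neg_zpow_units (x : ℂ) (u : ℤˣ) : (-x) ^ (u : ℤ) = -x ^ (u : ℤ) := by
  rcases Int.units_eq_one_or u with rfl | rfl <;> simp [inv_neg]

/-- An odd reordering of the vertices inverts the `X`-coordinates. -/
theorem xCoord_comp (g : Fin 4 → GL (Fin n) ℂ) (t : Fin 4 → ℕ) (ht : ∑ i, t i = n)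
    (σ : Perm (Fin 4)) :
    xCoord (g ∘ σ) (t ∘ σ) = xCoord g t ^ (Perm.sign σ : ℤ) := by
  rw [xCoord, xCoord, neg_zpow_units, ← Finset.prod_zpow]
  congr 1
  symm
  have inv : ∀ e : Fin 4 → ℕ, (e ∘ ⇑σ⁻¹) ∘ σ = e := fun e => by
    funext i
    simp
  refine Finset.prod_nbij' (· ∘ σ) (· ∘ ⇑σ⁻¹) ?_ ?_ ?_ (fun e _ => inv e) ?_
  · intro e he
    rw [Finset.mem_filter] at he ⊢
    exact ⟨comp_mem_simplexEdges σ he.1, fun i => he.2 _⟩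
  · intro e he
    rw [Finset.mem_filter] at he ⊢
    refine ⟨comp_mem_simplexEdges σ⁻¹ he.1, fun i => ?_⟩
    simpa using he.2 (σ⁻¹ i)
  · intro e he
    funext i
    simp
  · intro e he
    rw [Finset.mem_filter] at he
    refine (shape_comp g (t - e) e ?_ he.1 σ).symm
    rw [← sum_of_mem_simplexEdges he.1, ← Finset.sum_add_distrib, ← ht]
    exact Finset.sum_congr rfl fun i _ => Nat.sub_add_cancel (he.2 i)

end PermuteShapes

/-! ## Frames adapted to three flags -/

section Frames

open Equiv

variable {n : ℕ}

theorem diag_ne_zero_of_upper {A : GL (Fin n) ℂ} (hA : A ∈ upperGL n) (i : Fin n) :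
    A.1 i i ≠ 0 := by
  have h : A.1 i i * (A⁻¹).1 i i = 1 := by
    rw [← diag_mul_of_upper hA (inv_upper hA), ← Units.val_mul, mul_inv_cancel, Units.val_one,
      Matrix.one_apply_eq]
  exact left_ne_zero_of_mul_eq_one h

theorem upperGL_apply_eq_zero {A : GL (Fin n) ℂ} (hA : A ∈ upperGL n) {i j : Fin n} (h : j < i) :
    A.1 i j = 0 := hA h

/-- The determinant of the first `i` columns of `g 0`, the vector `w`, and the first `n - 1 - i`
columns of `g 1`. -/
noncomputable def splitDet (g : Fin 4 → GL (Fin n) ℂ) (i : Fin n) : (Fin n → ℂ) →ₗ[ℂ] ℂ :=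
  LinearMap.proj i ∘ₗ Matrix.cramer (columns g ![i + 1, n - 1 - i, 0, 0])

/-- Column `i`, the last of the `i + 1` columns taken from `g 0`, is a placeholder that the inserted
vector overwrites; Cramer's map supplies linearity. -/
theorem splitDet_apply (g : Fin 4 → GL (Fin n) ℂ) (i : Fin n) (w : Fin n → ℂ) :
    splitDet g i w = ((columns g ![i + 1, n - 1 - i, 0, 0]).updateCol i w).det :=
  Matrix.cramer_apply _ _ _

theorem columns_split_left (g : Fin 4 → GL (Fin n) ℂ) (i k : Fin n) (h : k ≤ i) :
    (columns g ![i + 1, n - 1 - i, 0, 0]).col k = (g 0).1.col k := by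
  ext r
  have := Fin.le_def.1 h
  exact columns_apply _ _ 0 _ _ _ (by simp only [Matrix.cons_val]; omega) (by simp)

theorem columns_split_right (g : Fin 4 → GL (Fin n) ℂ) (i j k : Fin n)
    (h : j.val = i.val + 1 + k.val) :
    (columns g ![i + 1, n - 1 - i, 0, 0]).col j = (g 1).1.col k := by
  ext r
  have := j.2
  exact columns_apply _ _ 1 _ _ _ (by simp only [Matrix.cons_val]; omega)
    (by simp only [Matrix.cons_val]; omega)

/-- Only the first two flags enter, so the two frames joined by a short edge share these
functionals. -/
theorem splitDet_congr {g g' : Fin 4 → GL (Fin n) ℂ} (h0 : g 0 = g' 0) (h1 : g 1 = g' 1)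
    (i : Fin n) : splitDet g i = splitDet g' i := by
  have h : columns g ![i + 1, n - 1 - i, 0, 0] = columns g' ![i + 1, n - 1 - i, 0, 0] := by
    refine Matrix.ext_col fun j => ?_
    rcases le_or_gt j i with hj | hj
    · rw [columns_split_left _ _ _ hj, columns_split_left _ _ _ hj, h0]
    · have hj' := Fin.lt_def.1 hj
      have e : j.val = i.val + 1 + (⟨j - (i + 1), by omega⟩ : Fin n).val := by
        simp only
        omega
      rw [columns_split_right _ _ _ _ e, columns_split_right _ _ _ _ e, h1]
  rw [splitDet, splitDet, h]

theorem splitDet_column_eq_zero (g : Fin 4 → GL (Fin n) ℂ) {i j : Fin n} (h : i ≠ j) :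
    splitDet g i ((columns g ![i + 1, n - 1 - i, 0, 0]).col j) = 0 := by
  rw [splitDet_apply]
  exact Matrix.det_updateCol_eq_zero h.symm

theorem splitDet_left_eq_zero (g : Fin 4 → GL (Fin n) ℂ) {i k : Fin n} (h : k < i) :
    splitDet g i ((g 0).1.col k) = 0 := by
  rw [← columns_split_left g i k h.le]
  exact splitDet_column_eq_zero g h.ne'

theorem splitDet_right_eq_zero (g : Fin 4 → GL (Fin n) ℂ) {i k : Fin n}
    (h : i.val + 1 + k.val < n) : splitDet g i ((g 1).1.col k) = 0 := by
  rw [← columns_split_right g i ⟨_, h⟩ k rfl]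
  exact splitDet_column_eq_zero g (Fin.ne_of_lt (Fin.lt_def.2 (by simp only; omega)))

theorem splitDet_left_self (g : Fin 4 → GL (Fin n) ℂ) (i : Fin n) :
    splitDet g i ((g 0).1.col i) = ptolemy g ![i + 1, n - 1 - i, 0, 0] := by
  rw [← columns_split_left g i i le_rfl, splitDet_apply, ptolemy]
  congr 1
  exact Matrix.updateCol_eq_self _ _

/-- The inserted vector stands in front of the columns of `g 1`, whereas the Ptolemy coordinate has
it behind them; the sign is the cost of moving it across. -/
theorem splitDet_two (g : Fin 4 → GL (Fin n) ℂ) (i : Fin n) (z : Fin n) (hz : z.val = 0) :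
    splitDet g i ((g 2).1.col z) = (-1) ^ (n - 1 - i.val) * ptolemy g ![i, n - 1 - i, 1, 0] := by
  have hi := i.2
  have key := ptolemy_swap g ![i, n - 1 - i, 1, 0] (by
    simp [Fin.sum_univ_four]; omega) 1
  change ptolemy (g ∘ swap 1 2) (![i.val, n - 1 - i, 1, 0] ∘ swap 1 2) = _ at key
  have e : (![i.val, n - 1 - i, 1, 0] ∘ swap (1 : Fin 4) 2) = ![i.val, 1, n - 1 - i, 0] := by
    funext a
    fin_cases a <;> rfl
  rw [e] at key
  have e2 : (-1 : ℂ) ^ (![i.val, n - 1 - i, 1, 0] (Fin.castSucc (1 : Fin 3)) *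
    ![i.val, n - 1 - i, 1, 0] (Fin.succ (1 : Fin 3))) = (-1) ^ (n - 1 - i.val) :=
    congrArg _ (mul_one _)
  rw [e2] at key
  rw [← key, splitDet_apply, ptolemy]
  congr 1
  ext r j
  have hj := j.2
  rcases lt_trichotomy j i with h | h | h
  · have h' := columns_apply (g ∘ swap 1 2) ![i.val, 1, n - 1 - i, 0] 0 r j j h (by simp)
    rw [h', Matrix.updateCol_ne h.ne]
    exact congrFun (columns_split_left g i j h.le) r
  · subst h
    have h' := columns_apply (g ∘ swap 1 2) ![j.val, 1, n - 1 - j, 0] 1 r j z (by simp [hz])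
      (by simp [hz])
    rw [h', Matrix.updateCol_self]
    rfl
  · have hij := Fin.lt_def.1 h
    have h' := columns_apply (g ∘ swap 1 2) ![i.val, 1, n - 1 - i, 0] 2 r j ⟨j - (i + 1), by omega⟩
      (by simp only [Matrix.cons_val]; omega) (by simp only [Matrix.cons_val]; omega)
    rw [h', Matrix.updateCol_ne h.ne']
    exact congrFun (columns_split_right g i j ⟨j - (i + 1), by omega⟩ (by simp only; omega)) r

theorem col_mul_eq_sum (A B : Matrix (Fin n) (Fin n) ℂ) (j : Fin n) :
    (A * B).col j = ∑ k, B k j • A.col k := by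
  ext r
  simp [Matrix.mul_apply, mul_comm]

theorem counterDiag_apply (i j : Fin n) :
    (counterDiag n).1 i j = if i = j.rev then 1 else 0 := by
  change ((Fin.revPerm (n := n)).permMatrix ℂ) i j = _
  rw [Equiv.Perm.permMatrix, PEquiv.toMatrix_apply]
  have h : i = j.rev ↔ j = i.rev :=
    ⟨fun h => by rw [h, Fin.rev_rev], fun h => by rw [h, Fin.rev_rev]⟩
  simp [Equiv.toPEquiv, h, eq_comm]

theorem col_mul_counterDiag (A : GL (Fin n) ℂ) (j : Fin n) :
    (A * counterDiag n).1.col j = A.1.col j.rev := by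
  rw [Units.val_mul, col_mul_eq_sum, Finset.sum_eq_single j.rev]
  · simp [counterDiag_apply]
  · intro k _ hk
    simp [counterDiag_apply, hk]
  · simp

/-- The flags of `g 0`, `g 1`, `g 2` are the translates by `τ` of the flags of the identity matrix,
the counter-diagonal matrix and a normalized lower triangular matrix. -/
structure IsFrame (g : Fin 4 → GL (Fin n) ℂ) (τ : GL (Fin n) ℂ) : Prop where
  zero : τ⁻¹ * g 0 ∈ upperGL n
  one : (τ * counterDiag n)⁻¹ * g 1 ∈ upperGL n
  two : ∃ m, IsNormalizedLower m ∧ (τ * m)⁻¹ * g 2 ∈ upperGL n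

variable {g : Fin 4 → GL (Fin n) ℂ} {τ τ' : GL (Fin n) ℂ}

theorem col_eq_sum_zero (g : Fin 4 → GL (Fin n) ℂ) (τ : GL (Fin n) ℂ) (j : Fin n) :
    τ.1.col j = ∑ k, ((τ⁻¹ * g 0)⁻¹).1 k j • (g 0).1.col k := by
  rw [← col_mul_eq_sum, ← Units.val_mul]
  simp

/-- The coefficients are triangular after the index reversal, so the last columns of a frame span
the flag of `g 1`, just as the first ones span that of `g 0`. -/
theorem col_eq_sum_one (g : Fin 4 → GL (Fin n) ℂ) (τ : GL (Fin n) ℂ) (j : Fin n) :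
    τ.1.col j = ∑ k, (((τ * counterDiag n)⁻¹ * g 1)⁻¹).1 k j.rev • (g 1).1.col k := by
  rw [← col_mul_eq_sum, ← Units.val_mul]
  rw [show g 1 * ((τ * counterDiag n)⁻¹ * g 1)⁻¹ = τ * counterDiag n by group,
    col_mul_counterDiag, Fin.rev_rev]

/-- For `j < i` the column is a combination of columns of `g 0` already in the determinant; for `j >
i`, of columns of `g 1` already there. -/
theorem IsFrame.splitDet_col_eq_zero (h : IsFrame g τ) {i j : Fin n} (hij : j ≠ i) :
    splitDet g i (τ.1.col j) = 0 := by
  rcases lt_or_gt_of_ne hij with hij | hij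
  · rw [col_eq_sum_zero g, map_sum]
    refine Finset.sum_eq_zero fun k _ => ?_
    rw [map_smul]
    rcases lt_or_ge j k with hk | hk
    · rw [upperGL_apply_eq_zero (inv_mem h.zero) hk, zero_smul]
    · rw [splitDet_left_eq_zero g (hk.trans_lt hij), smul_zero]
  · rw [col_eq_sum_one g, map_sum]
    refine Finset.sum_eq_zero fun k _ => ?_
    rw [map_smul]
    rcases lt_or_ge j.rev k with hk | hk
    · rw [upperGL_apply_eq_zero (inv_mem h.one) hk, zero_smul]
    · have := Fin.le_def.1 hk
      have := Fin.lt_def.1 hij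
      rw [Fin.val_rev] at *
      rw [splitDet_right_eq_zero g (by omega), smul_zero]

/-- The functional `splitDet g i` is a multiple of the `i`-th coordinate in a frame. -/
theorem IsFrame.splitDet_mul_col (h : IsFrame g τ) (A : Matrix (Fin n) (Fin n) ℂ) (i j : Fin n) :
    splitDet g i ((τ.1 * A).col j) = splitDet g i (τ.1.col i) * A i j := by
  rw [col_mul_eq_sum, map_sum, Finset.sum_eq_single i]
  · rw [map_smul, smul_eq_mul, mul_comm]
  · intro k _ hk
    rw [map_smul, h.splitDet_col_eq_zero hk, smul_zero]
  · simp

/-- Only the leading term of the expansion in columns of `g 0` survives. Since `g'` is free away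
from the first flag, one leading coefficient can be tested against two different functionals. -/
theorem IsFrame.splitDet_col (h : IsFrame g τ) (i : Fin n) (g' : Fin 4 → GL (Fin n) ℂ)
    (h0 : g' 0 = g 0) :
    splitDet g' i (τ.1.col i) =
      ((τ⁻¹ * g 0)⁻¹).1 i i * ptolemy g' ![i + 1, n - 1 - i, 0, 0] := by
  rw [col_eq_sum_zero g, map_sum, Finset.sum_eq_single i]
  · rw [map_smul, smul_eq_mul, ← h0, splitDet_left_self]
  · intro k _ hk
    rw [map_smul]
    rcases lt_or_gt_of_ne hk with hk | hk
    · rw [← h0, splitDet_left_eq_zero g' hk, smul_zero]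
    · rw [upperGL_apply_eq_zero (inv_mem h.zero) hk, zero_smul]
  · simp

/-- The first column of the normalized matrix is all ones, and a triangular right factor only
rescales it. -/
theorem IsFrame.exists_coord_two (h : IsFrame g τ) (z : Fin n) (hz : z.val = 0) :
    ∃ c : ℂ, c ≠ 0 ∧ ∀ i, (τ⁻¹ * g 2).1 i z = c := by
  obtain ⟨m, hm, hu⟩ := h.two
  refine ⟨_, diag_ne_zero_of_upper hu z, fun i => ?_⟩
  have : τ⁻¹ * g 2 = m * ((τ * m)⁻¹ * g 2) := by group
  rw [this, Units.val_mul, Matrix.mul_apply, Finset.sum_eq_single z]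
  · rw [hm.2.2 i z hz, one_mul]
  · intro k _ hk
    rw [upperGL_apply_eq_zero hu (Fin.lt_def.2 (by
      have := Fin.val_ne_of_ne hk
      omega)), mul_zero]
  · simp

theorem IsFrame.exists_splitDet_two (hn : 0 < n) (h : IsFrame g τ) :
    ∃ c : ℂ, c ≠ 0 ∧ ∀ i : Fin n, splitDet g i (τ.1.col i) * c =
      (-1) ^ (n - 1 - i.val) * ptolemy g ![i, n - 1 - i, 1, 0] := by
  obtain ⟨c, hc, h2⟩ := h.exists_coord_two ⟨0, hn⟩ rfl
  refine ⟨c, hc, fun i => ?_⟩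
  rw [← splitDet_two g i ⟨0, hn⟩ rfl, ← h2 i, ← h.splitDet_mul_col, ← Units.val_mul,
    mul_inv_cancel_left]

theorem neg_one_pow_mul_self (k : ℕ) : (-1 : ℂ) ^ k * (-1) ^ k = 1 := by
  rw [← mul_pow]
  simp

/-- The diagonal entries of the label of a short edge. -/
theorem IsFrame.short_entry (hn : 0 < n) (h : IsFrame g τ) (h' : IsFrame (g ∘ swap 2 3) τ') :
    ∃ c : ℂ, c ≠ 0 ∧ ∀ i : Fin n, (τ⁻¹ * τ').1 i i * ptolemy g ![i, n - 1 - i, 1, 0] =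
      c * ptolemy g ![i, n - 1 - i, 0, 1] := by
  obtain ⟨c, hc, hκ⟩ := h.exists_splitDet_two hn
  obtain ⟨c', hc', hκ'⟩ := h'.exists_splitDet_two hn
  refine ⟨c / c', div_ne_zero hc hc', fun i => ?_⟩
  -- The same functional evaluated in both frames: the diagonal entry of the label is the quotient
  -- of the two normalizing factors.
  have h1 : splitDet (g ∘ swap 2 3) i (τ'.1.col i) =
      splitDet g i (τ.1.col i) * (τ⁻¹ * τ').1 i i := by
    rw [← h.splitDet_mul_col, ← Units.val_mul, mul_inv_cancel_left]
    rw [splitDet_congr (g := g ∘ swap 2 3) (g' := g) rfl rfl]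
  have h2 : ptolemy (g ∘ swap 2 3) ![i, n - 1 - i, 1, 0] = ptolemy g ![i, n - 1 - i, 0, 1] := by
    have e : (![i.val, n - 1 - i, 0, 1] ∘ swap (2 : Fin 4) 3) = ![i.val, n - 1 - i, 1, 0] := by
      funext a
      fin_cases a <;> rfl
    rw [← e]
    refine (ptolemy_swap g ![i, n - 1 - i, 0, 1] ?_ 2).trans ?_
    · simp [Fin.sum_univ_four]
      omega
    · change (-1) ^ (0 * 1) * _ = _
      simp
  have k1 := hκ i
  have k2 := hκ' i
  rw [h1, h2] at k2
  have s := neg_one_pow_mul_self (n - 1 - i.val)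
  generalize (-1 : ℂ) ^ (n - 1 - i.val) = δ at *
  rw [div_mul_eq_mul_div, eq_div_iff hc']
  linear_combination (-(τ⁻¹ * τ').1 i i * δ * c') * k1 + c * δ * k2 +
    ((c * ptolemy g ![i, n - 1 - i, 0, 1]) -
      (τ⁻¹ * τ').1 i i * c' * ptolemy g ![i, n - 1 - i, 1, 0]) * s

/-- The diagonal entries of the label of a middle edge. -/
theorem IsFrame.middle_entry (hn : 0 < n) (h : IsFrame g τ) (h' : IsFrame (g ∘ swap 1 2) τ') :
    ∃ c : ℂ, c ≠ 0 ∧ ∀ i : Fin n,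
      (τ⁻¹ * τ').1 i i * (ptolemy g ![i, n - 1 - i, 1, 0] * ptolemy g ![i + 1, 0, n - 1 - i, 0]) =
      c * (-1) ^ (n - 1 - i.val) *
        (ptolemy g ![i + 1, n - 1 - i, 0, 0] * ptolemy g ![i, 1, n - 1 - i, 0]) := by
  obtain ⟨c, hc, hκ⟩ := h.exists_splitDet_two hn
  obtain ⟨c', hc', hκ'⟩ := h'.exists_splitDet_two hn
  refine ⟨c / c', div_ne_zero hc hc', fun i => ?_⟩
  have h1 : splitDet g i (τ'.1.col i) = splitDet g i (τ.1.col i) * (τ⁻¹ * τ').1 i i := by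
    rw [← h.splitDet_mul_col, ← Units.val_mul, mul_inv_cancel_left]
  -- The leading coefficient of the column of `τ'` is unknown. The functional of `g` (in `h2`) and
  -- that of the reordered flags (in `h3`) both involve it, so it can be eliminated.
  have h2 := h'.splitDet_col i g rfl
  have h3 := h'.splitDet_col i _ rfl
  have e1 : ptolemy (g ∘ swap 1 2) ![i, n - 1 - i, 1, 0] =
      (-1) ^ (n - 1 - i.val) * ptolemy g ![i, 1, n - 1 - i, 0] := by
    have e : (![i.val, 1, n - 1 - i, 0] ∘ swap (1 : Fin 4) 2) = ![i.val, n - 1 - i, 1, 0] := by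
      funext a
      fin_cases a <;> rfl
    rw [← e]
    refine (ptolemy_swap g ![i, 1, n - 1 - i, 0] ?_ 1).trans ?_
    · simp [Fin.sum_univ_four]
      omega
    · change (-1) ^ (1 * (n - 1 - i.val)) * _ = _
      simp
  have e2 : ptolemy (g ∘ swap 1 2) ![i + 1, n - 1 - i, 0, 0] =
      ptolemy g ![i + 1, 0, n - 1 - i, 0] := by
    have e : (![i.val + 1, 0, n - 1 - i, 0] ∘ swap (1 : Fin 4) 2) =
        ![i.val + 1, n - 1 - i, 0, 0] := by
      funext a
      fin_cases a <;> rfl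
    rw [← e]
    refine (ptolemy_swap g ![i + 1, 0, n - 1 - i, 0] ?_ 1).trans ?_
    · simp [Fin.sum_univ_four]
      omega
    · change (-1) ^ (0 * (n - 1 - i.val)) * _ = _
      simp
  have k1 := hκ i
  have k2 := hκ' i
  rw [h3, e1, e2] at k2
  rw [h1] at h2
  have s := neg_one_pow_mul_self (n - 1 - i.val)
  generalize (-1 : ℂ) ^ (n - 1 - i.val) = δ at *
  generalize ((τ'⁻¹ * (g ∘ ⇑(swap 1 2)) 0)⁻¹).1 i i = a at *
  generalize (τ⁻¹ * τ').1 i i = b at *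
  generalize ptolemy g ![i, n - 1 - i, 1, 0] = P at *
  generalize ptolemy g ![i + 1, 0, n - 1 - i, 0] = Q at *
  generalize ptolemy g ![i + 1, n - 1 - i, 0, 0] = R at *
  generalize ptolemy g ![i, 1, n - 1 - i, 0] = S at *
  generalize splitDet g i (τ.1.col i) = κ at *
  have hS : S = a * Q * c' := by
    linear_combination -k2 - S * s
  have hP : P = δ * κ * c := by
    linear_combination -δ * k1 - P * s
  rw [div_mul_eq_mul_div, div_mul_eq_mul_div, eq_div_iff hc', hS, hP]
  linear_combination (δ * c * Q * c') * h2

end Frames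

/-! ## Ratios of consecutive diagonal entries -/

section Ratios

open Equiv

variable {n : ℕ} {g : Fin 4 → GL (Fin n) ℂ}

/-- The `X`-coordinate at an interior point of the face `012` in terms of Ptolemy coordinates. -/
theorem xCoord_face (hg : ∀ t : Fin 4 → ℕ, ∑ i, t i = n → ptolemy g t ≠ 0) (a b c : ℕ)
    (h : a + b + c + 3 = n) :
    xCoord g ![a + 1, b + 1, c + 1, 0] =
      ptolemy g ![a, b + 1, c + 2, 0] * ptolemy g ![a + 2, b, c + 1, 0] *
          ptolemy g ![a + 1, b + 2, c, 0] /
        (ptolemy g ![a + 1, b, c + 2, 0] * ptolemy g ![a + 2, b + 1, c, 0] *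
          ptolemy g ![a, b + 2, c + 1, 0]) := by
  have hne : ∀ p q r s : ℕ, p + q + r + s = n → ptolemy g ![p, q, r, s] ≠ 0 := fun p q r s h =>
    hg _ (by rw [Fin.sum_univ_four]; exact h)
  -- The point lies on the face opposite vertex 3, so only the three edges avoiding that vertex fit
  -- below it.
  have hE : simplexEdges.filter (fun e => ∀ i, e i ≤ ![a + 1, b + 1, c + 1, 0] i) =
      {![1, 1, 0, 0], ![1, 0, 1, 0], ![0, 1, 1, 0]} := by
    rw [simplexEdges]
    simp [Finset.filter_insert, Finset.filter_singleton, Fin.forall_fin_succ]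
  have hz : shape g ![a, b, c + 1, 0] ![1, 1, 0, 0] =
      ptolemy g ![a + 1, b, c + 1, 1] * ptolemy g ![a, b + 1, c + 2, 0] /
        (ptolemy g ![a + 1, b, c + 2, 0] * ptolemy g ![a, b + 1, c + 1, 1]) := by
    rw [shape, if_pos (by decide)]
    simp
  have hz' : shape g ![a, b + 1, c, 0] ![1, 0, 1, 0] =
      -(ptolemy g ![a + 1, b + 2, c, 0] * ptolemy g ![a, b + 1, c + 1, 1] /
        (ptolemy g ![a + 1, b + 1, c, 1] * ptolemy g ![a, b + 2, c + 1, 0])) := by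
    rw [shape, if_neg (by decide), if_neg (by decide), if_pos (by decide)]
    simp
  have hz'' : shape g ![a + 1, b, c, 0] ![0, 1, 1, 0] =
      ptolemy g ![a + 1, b + 1, c, 1] * ptolemy g ![a + 2, b, c + 1, 0] /
        (ptolemy g ![a + 2, b + 1, c, 0] * ptolemy g ![a + 1, b, c + 1, 1]) := by
    rw [shape, if_neg (by decide), if_pos (by decide)]
    simp
  rw [xCoord, hE, Finset.prod_insert (by decide), Finset.prod_insert (by decide),
    Finset.prod_singleton]
  have e1 : ![a + 1, b + 1, c + 1, 0] - ![1, 1, 0, 0] = ![a, b, c + 1, 0] := by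
    funext i
    fin_cases i <;> rfl
  have e2 : ![a + 1, b + 1, c + 1, 0] - ![1, 0, 1, 0] = ![a, b + 1, c, 0] := by
    funext i
    fin_cases i <;> rfl
  have e3 : ![a + 1, b + 1, c + 1, 0] - ![0, 1, 1, 0] = ![a + 1, b, c, 0] := by
    funext i
    fin_cases i <;> rfl
  rw [e1, e2, e3, hz, hz', hz'']
  -- These three coordinates lie off the face. Each occurs once above and once below a fraction bar,
  -- so they cancel and leave the six neighbours of the point within the face.
  have h1 := hne (a + 1) b (c + 1) 1 (by omega)
  have h2 := hne a (b + 1) (c + 1) 1 (by omega)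
  have h3 := hne (a + 1) (b + 1) c 1 (by omega)
  have h4 := hne (a + 1) b (c + 2) 0 (by omega)
  have h5 := hne (a + 2) (b + 1) c 0 (by omega)
  have h6 := hne a (b + 2) (c + 1) 0 (by omega)
  field_simp

/-- Consecutive points on the line of first coordinate `a + 1` have overlapping hexagons of
neighbours, so the product telescopes and only terms at its two ends remain. Partial products are
stated so that induction applies; the full row `K = N` is what is needed. -/
theorem prod_xCoord_face (hg : ∀ t : Fin 4 → ℕ, ∑ i, t i = n → ptolemy g t ≠ 0) (a N : ℕ)
    (h : a + 2 + N = n) (K : ℕ) (hK : K ≤ N) :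
    ∏ k ∈ Finset.Icc 1 K, xCoord g ![a + 1, N + 1 - k, k, 0] =
      ptolemy g ![a, N + 1 - K, K + 1, 0] * ptolemy g ![a + 2, N - K, K, 0] *
          (ptolemy g ![a + 1, N + 1, 0, 0] * ptolemy g ![a + 1, N, 1, 0]) /
        (ptolemy g ![a, N + 1, 1, 0] * ptolemy g ![a + 2, N, 0, 0] *
          (ptolemy g ![a + 1, N + 1 - K, K, 0] * ptolemy g ![a + 1, N - K, K + 1, 0])) := by
  have hne : ∀ p q r s : ℕ, p + q + r + s = n → ptolemy g ![p, q, r, s] ≠ 0 := fun p q r s h =>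
    hg _ (by rw [Fin.sum_univ_four]; exact h)
  have h1 := hne a (N + 1) 1 0 (by omega)
  have h2 := hne (a + 2) N 0 0 (by omega)
  have h3 := hne (a + 1) (N + 1) 0 0 (by omega)
  have h4 := hne (a + 1) N 1 0 (by omega)
  induction K with
  | zero =>
    simp only [Finset.Icc_eq_empty_of_lt zero_lt_one, Finset.prod_empty, Nat.sub_zero, zero_add]
    field_simp
  | succ K ih =>
    rw [Finset.prod_Icc_succ_top (by omega), ih (by omega)]
    obtain ⟨b, rfl⟩ : ∃ b, N = b + 1 + K := ⟨N - 1 - K, by omega⟩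
    have s1 : b + 1 + K + 1 - K = b + 2 := by omega
    have s2 : b + 1 + K - K = b + 1 := by omega
    have s3 : b + 1 + K + 1 - (K + 1) = b + 1 := by omega
    have s4 : b + 1 + K - (K + 1) = b := by omega
    rw [s1, s2, s3, s4, xCoord_face hg a b K (by omega)]
    have h5 := hne (a + 1) b (K + 2) 0 (by omega)
    have h6 := hne (a + 2) (b + 1) K 0 (by omega)
    have h7 := hne a (b + 2) (K + 1) 0 (by omega)
    have h8 := hne (a + 1) (b + 2) K 0 (by omega)
    have h9 := hne (a + 1) (b + 1) (K + 1) 0 (by omega)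
    field_simp

/-- The end terms of the telescoped row are precisely the Ptolemy coordinates in the two diagonal
entries; the common constant `c` cancels. -/
theorem diag_ratio_middle (hg : ∀ t : Fin 4 → ℕ, ∑ i, t i = n → ptolemy g t ≠ 0)
    {τ τ' : GL (Fin n) ℂ} (h : IsFrame g τ) (h' : IsFrame (g ∘ swap 1 2) τ') (i j : Fin n)
    (hij : j.val = i.val + 1) :
    (τ⁻¹ * τ').1 i i / (τ⁻¹ * τ').1 j j =
      -∏ k ∈ Finset.Icc 1 (n - 1 - j), xCoord g ![j, n - k - j, k, 0] := by
  have hj := j.2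
  obtain ⟨c, hc, hE⟩ := h.middle_entry (by omega) h'
  have hi := hE i
  have hj' := hE j
  rw [hij] at hj'
  obtain ⟨N, hN⟩ : ∃ N, i.val + 2 + N = n := ⟨n - (i + 2), by omega⟩
  generalize (τ⁻¹ * τ').1 i i = x at *
  generalize (τ⁻¹ * τ').1 j j = y at *
  rw [hij]
  generalize i.val = a at *
  have hne : ∀ p q r s : ℕ, p + q + r + s = n → ptolemy g ![p, q, r, s] ≠ 0 := fun p q r s h =>
    hg _ (by rw [Fin.sum_univ_four]; exact h)
  have s1 : n - 1 - a = N + 1 := by omega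
  have s2 : n - 1 - (a + 1) = N := by omega
  have hP : ∏ k ∈ Finset.Icc 1 N, xCoord g ![a + 1, n - k - (a + 1), k, 0] =
      ∏ k ∈ Finset.Icc 1 N, xCoord g ![a + 1, N + 1 - k, k, 0] :=
    Finset.prod_congr rfl fun k _ => by rw [show n - k - (a + 1) = N + 1 - k by omega]
  rw [s1] at hi
  rw [s2, show a + 1 + 1 = a + 2 from rfl] at hj'
  rw [s2, hP, prod_xCoord_face hg a N hN N le_rfl, Nat.sub_self, Nat.add_sub_cancel_left]
  have h1 := hne a (N + 1) 1 0 (by omega)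
  have h2 := hne (a + 1) 0 (N + 1) 0 (by omega)
  have h3 := hne (a + 2) N 0 0 (by omega)
  have h4 := hne (a + 1) 1 N 0 (by omega)
  have h5 := hne (a + 1) N 1 0 (by omega)
  have h6 := hne (a + 2) 0 N 0 (by omega)
  have hδ : (-1 : ℂ) ^ N ≠ 0 := pow_ne_zero _ (by simp)
  -- The sign exponents of the two entries are `N + 1` and `N`; their difference is the source of
  -- the minus sign.
  rw [pow_succ] at hi
  generalize (-1 : ℂ) ^ N = δ at *
  have hx := eq_div_of_mul_eq (mul_ne_zero h1 h2) hi
  have hy := eq_div_of_mul_eq (mul_ne_zero h5 h6) hj'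
  rw [hx, hy]
  field_simp

theorem diag_ratio_short (hg : ∀ t : Fin 4 → ℕ, ∑ i, t i = n → ptolemy g t ≠ 0)
    {τ τ' : GL (Fin n) ℂ} (h : IsFrame g τ) (h' : IsFrame (g ∘ swap 2 3) τ') (i j : Fin n)
    (hij : j.val = i.val + 1) :
    (τ⁻¹ * τ').1 i i / (τ⁻¹ * τ').1 j j =
      (shape g ![i, n - 1 - j, 0, 0] ![1, 1, 0, 0])⁻¹ := by
  have hj := j.2
  obtain ⟨c, hc, hE⟩ := h.short_entry (by omega) h'
  have hi := hE i
  have hj' := hE j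
  rw [hij] at hj'
  obtain ⟨N, hN⟩ : ∃ N, i.val + 2 + N = n := ⟨n - (i + 2), by omega⟩
  generalize (τ⁻¹ * τ').1 i i = x at *
  generalize (τ⁻¹ * τ').1 j j = y at *
  rw [hij]
  generalize i.val = a at *
  have hne : ∀ p q r s : ℕ, p + q + r + s = n → ptolemy g ![p, q, r, s] ≠ 0 := fun p q r s h =>
    hg _ (by rw [Fin.sum_univ_four]; exact h)
  have s1 : n - 1 - a = N + 1 := by omega
  have s2 : n - 1 - (a + 1) = N := by omega
  rw [s1] at hi
  rw [s2] at hj' ⊢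
  have hz : shape g ![a, N, 0, 0] ![1, 1, 0, 0] =
      ptolemy g ![a + 1, N, 0, 1] * ptolemy g ![a, N + 1, 1, 0] /
        (ptolemy g ![a + 1, N, 1, 0] * ptolemy g ![a, N + 1, 0, 1]) := by
    rw [shape, if_pos (by decide)]
    simp
  have h1 := hne a (N + 1) 1 0 (by omega)
  have h2 := hne (a + 1) N 1 0 (by omega)
  have h3 := hne (a + 1) N 0 1 (by omega)
  have h4 := hne a (N + 1) 0 1 (by omega)
  have hx := eq_div_of_mul_eq h1 hi
  have hy := eq_div_of_mul_eq h2 hj'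
  rw [hx, hy, hz]
  field_simp

end Ratios

/-! ## Projective classes of triangular matrices -/

section Projective

open Matrix.ProjGenLinGroup

variable {n : ℕ}

theorem exists_apply_eq_mul_of_mk_eq {A B : GL (Fin n) ℂ}
    (h : (mk A : PGL(n, ℂ)) = mk B) : ∃ u : ℂˣ, ∀ i j, A.1 i j = u * B.1 i j := by
  obtain ⟨u, hu⟩ := mk_eq_mk_iff.1 h.symm
  refine ⟨u, fun i j => ?_⟩
  rw [← hu]
  simp [mul_comm]

theorem mk_mul_scalar (A : GL (Fin n) ℂ) (u : ℂˣ) :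
    (mk (A * Matrix.GeneralLinearGroup.scalar (Fin n) u) : PGL(n, ℂ)) = mk A := by
  rw [map_mul, mk_scalar, mul_one]

theorem mul_scalar_apply (A : GL (Fin n) ℂ) (u : ℂˣ) (i j : Fin n) :
    (A * Matrix.GeneralLinearGroup.scalar (Fin n) u).1 i j = A.1 i j * u := by
  simp

/-- Scaling does not affect zeros below the diagonal, so membership in `B` lifts from PGL to GL. -/
theorem mem_upperGL_of_cosetB_eq {g t h : GL (Fin n) ℂ}
    (H : cosetB g = (mk t : PGL(n, ℂ)) • cosetB h) : (t * h)⁻¹ * g ∈ upperGL n := by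
  have H' : (mk t * mk h : PGL(n, ℂ))⁻¹ * mk g ∈ borelPGL n := QuotientGroup.eq.1 H.symm
  rw [← map_mul, ← map_inv, ← map_mul] at H'
  obtain ⟨b, hb, hbg⟩ := H'
  obtain ⟨u, hu⟩ := exists_apply_eq_mul_of_mk_eq hbg.symm
  intro i j hij
  rw [hu, hb hij, mul_zero]

theorem diagEntry_eq (A : GL (Fin n) ℂ) {l : ℕ} (i : Fin n) (h : l = i.val + 1) :
    ConcreteTriangulation.diagEntry A l = A.1 i i := by
  subst h
  have hi := i.2
  rw [ConcreteTriangulation.diagEntry, dif_pos ⟨by omega, by omega⟩]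
  rfl

theorem diagEntry_mul {A B : GL (Fin n) ℂ} (hA : A ∈ upperGL n) (hB : B ∈ upperGL n) (l : ℕ) :
    ConcreteTriangulation.diagEntry (A * B) l =
      ConcreteTriangulation.diagEntry A l * ConcreteTriangulation.diagEntry B l := by
  simp only [ConcreteTriangulation.diagEntry]
  split_ifs
  · exact diag_mul_of_upper hA hB _
  · simp

variable (n) in
/-- The invertible upper triangular matrices with last diagonal entry `1`. -/
def cornerOneGL : Subgroup (GL (Fin n) ℂ) where
  carrier := {A | A ∈ upperGL n ∧ ∀ i : Fin n, i.val + 1 = n → A.1 i i = 1}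
  one_mem' := ⟨one_mem _, fun i _ => Matrix.one_apply_eq i⟩
  mul_mem' := by
    rintro A B ⟨hA, hA'⟩ ⟨hB, hB'⟩
    exact ⟨mul_mem hA hB, fun i hi => by
      rw [Units.val_mul, diag_mul_of_upper hA hB, hA' i hi, hB' i hi, one_mul]⟩
  inv_mem' := by
    rintro A ⟨hA, hA'⟩
    refine ⟨inv_mem hA, fun i hi => ?_⟩
    have h : (A.1 * (A⁻¹).1) i i = 1 := by
      rw [← Units.val_mul, mul_inv_cancel, Units.val_one, Matrix.one_apply_eq]
    rwa [diag_mul_of_upper hA (inv_upper hA), hA' i hi, one_mul] at h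

/-- The scalar relating two representatives is read off the last diagonal entry. This rigidity
yields both the cocycle identities and the uniqueness of the canonical lift. -/
theorem eq_of_mk_eq_of_mem_cornerOneGL (hn : 0 < n) {A B : GL (Fin n) ℂ} (hA : A ∈ cornerOneGL n)
    (hB : B ∈ cornerOneGL n) (h : (mk A : PGL(n, ℂ)) = mk B) : A = B := by
  obtain ⟨u, hu⟩ := exists_apply_eq_mul_of_mk_eq h
  have h1 := hu ⟨n - 1, by omega⟩ ⟨n - 1, by omega⟩
  rw [hA.2 _ (by simp only; omega), hB.2 _ (by simp only; omega), mul_one] at h1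
  ext i j
  rw [hu, ← h1, one_mul]

/-- Diagonals of triangular matrices multiply, so conjugation by a triangular matrix leaves the
diagonal unchanged. -/
theorem mul_inv_conj_mem_unipotentGL {Q U : GL (Fin n) ℂ} (hQ : Q ∈ upperGL n)
    (hU : U ∈ unipotentGL n) : Q⁻¹ * U * Q ∈ unipotentGL n := by
  have hU' : U ∈ upperGL n := hU.1
  refine ⟨mul_mem (mul_mem (inv_mem hQ) hU') hQ, fun i => ?_⟩
  rw [Units.val_mul, diag_mul_of_upper (mul_mem (inv_mem hQ) hU') hQ, Units.val_mul,
    diag_mul_of_upper (inv_mem hQ) hU', hU.2, mul_one,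
    ← diag_mul_of_upper (inv_mem hQ) hQ, ← Units.val_mul, inv_mul_cancel, Units.val_one,
    Matrix.one_apply_eq]

/-- An upper triangular matrix with last diagonal entry `1` that is projectively conjugate to a
unipotent matrix is unipotent. -/
theorem mem_unipotentGL_of_mk_eq_conj (hn : 0 < n) {A : GL (Fin n) ℂ} (hA : A ∈ cornerOneGL n)
    {h u : PGL(n, ℂ)} (hu : u ∈ unipotentPGL n) (hAu : mk A = h * u * h⁻¹) :
    A ∈ unipotentGL n := by
  obtain ⟨U, hU, rfl⟩ := hu
  obtain ⟨H, rfl⟩ := mk_surjective h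
  rw [← map_mul, ← map_inv, ← map_mul] at hAu
  obtain ⟨c, hc⟩ := exists_apply_eq_mul_of_mk_eq hAu
  have hcU : (c.1 • U.1).BlockTriangular id := fun i j hij => by
    rw [Matrix.smul_apply, hU.1 hij, smul_zero]
  have hA' : A.1 = H.1 * (c.1 • U.1) * (H⁻¹).1 := by
    ext i j
    rw [hc, Matrix.mul_smul, Matrix.smul_mul, Matrix.smul_apply, Units.val_mul, Units.val_mul,
      smul_eq_mul]
  -- The characteristic polynomial forgets the conjugation and keeps the scalar `c`. All diagonal
  -- entries of `A` are therefore `c`, and the last one forces `c = 1`.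
  have hchar : A.1.charpoly = (Polynomial.X - Polynomial.C c.1) ^ n := by
    rw [hA', Matrix.coe_units_inv]
    refine (Matrix.charpoly_units_conj H (c.1 • U.1)).trans ?_
    rw [Matrix.charpoly_of_isUpperTriangular _ hcU]
    simp [hU.2]
  have hdiag : ∀ i, A.1 i i = c.1 := by
    intro i
    have h0 : A.1.charpoly.eval (A.1 i i) = 0 := by
      rw [Matrix.charpoly_of_isUpperTriangular _ hA.1, Polynomial.eval_prod]
      exact Finset.prod_eq_zero (Finset.mem_univ i) (by simp)
    rw [hchar] at h0
    simp only [Polynomial.eval_pow, Polynomial.eval_sub, Polynomial.eval_X,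
      Polynomial.eval_C] at h0
    exact sub_eq_zero.1 ((pow_eq_zero_iff hn.ne').1 h0)
  refine ⟨hA.1, fun i => ?_⟩
  rw [hdiag i, ← hdiag ⟨n - 1, by omega⟩, hA.2 _ (by simp only; omega)]

end Projective

/-! ## Labels of middle and short edges -/

section Labels

open Equiv Matrix.ProjGenLinGroup

variable {n : ℕ} {g : Fin 4 → GL (Fin n) ℂ} {τ τ' : GL (Fin n) ℂ}

/-- Two frames carrying the standard flag to the same flag differ by an element of its stabilizer.
-/
theorem inv_mul_mem_upperGL {a : GL (Fin n) ℂ} (h : τ⁻¹ * a ∈ upperGL n)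
    (h' : τ'⁻¹ * a ∈ upperGL n) : τ⁻¹ * τ' ∈ upperGL n := by
  have := mul_mem h (inv_mem h')
  rwa [mul_inv_rev, inv_inv, mul_assoc, mul_inv_cancel_left] at this

theorem counterDiag_mul_apply (A : GL (Fin n) ℂ) (i j : Fin n) :
    (counterDiag n * A).1 i j = A.1 i.rev j := by
  rw [Units.val_mul, Matrix.mul_apply, Finset.sum_eq_single i.rev]
  · simp [counterDiag_apply]
  · intro k _ hk
    rw [counterDiag_apply, if_neg, zero_mul]
    rintro rfl
    simp at hk
  · simp

/-- The last column of `τ'` spans the line of the flag `g 2`, whose coordinates in `τ` are all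
equal. The last column of `τ⁻¹ * τ'` is thus a nonzero constant, which the scalar turns into ones.
-/
theorem IsFrame.exists_middle_label (hn : 0 < n) (h : IsFrame g τ)
    (h' : IsFrame (g ∘ swap 1 2) τ') :
    ∃ A : GL (Fin n) ℂ, 
      (Matrix.ProjGenLinGroup.mk A : PGL(n, ℂ)) = Matrix.ProjGenLinGroup.mk (τ⁻¹ * τ') ∧ A ∈ upperGL n ∧
      ∀ i j : Fin n, j.val + 1 = n → A.1 i j = 1 := by
  have hu : τ⁻¹ * τ' ∈ upperGL n := inv_mul_mem_upperGL h.zero h'.zero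
  obtain ⟨c, hc, h2⟩ := h.exists_coord_two ⟨0, hn⟩ rfl
  obtain ⟨U, hU⟩ : ∃ U, U = (τ' * counterDiag n)⁻¹ * g 2 := ⟨_, rfl⟩
  have hU' : U ∈ upperGL n := hU ▸ h'.one
  have hd := diag_ne_zero_of_upper hU' ⟨0, hn⟩
  have hcol : ∀ i j : Fin n, j.val + 1 = n →
      (τ⁻¹ * τ').1 i j * U.1 ⟨0, hn⟩ ⟨0, hn⟩ = c := by
    intro i j hj
    rw [← h2 i]
    have e : τ⁻¹ * g 2 = (τ⁻¹ * τ') * counterDiag n * U := by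
      rw [hU]
      group
    rw [e]
    generalize τ⁻¹ * τ' = V
    rw [Units.val_mul, Matrix.mul_apply, Finset.sum_eq_single ⟨0, hn⟩]
    · have := congrFun (col_mul_counterDiag V ⟨0, hn⟩) i
      simp only [Matrix.col_apply] at this
      have hj' : j = (⟨0, hn⟩ : Fin n).rev := Fin.ext (by simp only [Fin.val_rev]; omega)
      rw [this, ← hj']
    · intro k _ hk
      rw [upperGL_apply_eq_zero hU' (Fin.lt_def.2 (by
        have := Fin.val_ne_of_ne hk
        simp only at this ⊢
        omega)), mul_zero]
    · simp
  refine ⟨τ⁻¹ * τ' * Matrix.GeneralLinearGroup.scalar (Fin n)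
    (Units.mk0 (U.1 ⟨0, hn⟩ ⟨0, hn⟩ / c) (div_ne_zero hd hc)), mk_mul_scalar _ _, ?_, ?_⟩
  · intro i j hij
    rw [mul_scalar_apply, hu hij, zero_mul]
  · intro i j hj
    rw [mul_scalar_apply, Units.val_mk0, ← mul_div_assoc, hcol i j hj, div_self hc]

/-- Preserving the flag of `g 0` makes the label upper triangular. Preserving that of `g 1` makes
its conjugate by `counterDiag` upper triangular, hence the label itself lower triangular. -/
theorem IsFrame.exists_short_label (hn : 0 < n) (h : IsFrame g τ)
    (h' : IsFrame (g ∘ swap 2 3) τ') :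
    ∃ A : GL (Fin n) ℂ, 
      (Matrix.ProjGenLinGroup.mk A : PGL(n, ℂ)) = Matrix.ProjGenLinGroup.mk (τ⁻¹ * τ') ∧ A.1.IsDiag ∧
      ∀ i : Fin n, i.val + 1 = n → A.1 i i = 1 := by
  have hu : τ⁻¹ * τ' ∈ upperGL n := inv_mul_mem_upperGL h.zero h'.zero
  have hv : (τ * counterDiag n)⁻¹ * (τ' * counterDiag n) ∈ upperGL n :=
    inv_mul_mem_upperGL h.one h'.one
  set z : Fin n := ⟨n - 1, by omega⟩
  have hd := diag_ne_zero_of_upper hu z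
  refine ⟨τ⁻¹ * τ' * Matrix.GeneralLinearGroup.scalar (Fin n)
    (Units.mk0 ((τ⁻¹ * τ').1 z z)⁻¹ (inv_ne_zero hd)), mk_mul_scalar _ _, ?_, ?_⟩
  · intro i j hij
    rw [mul_scalar_apply]
    rcases lt_or_gt_of_ne hij with hij | hij
    · have e : (τ⁻¹ * τ') * counterDiag n =
          counterDiag n * ((τ * counterDiag n)⁻¹ * (τ' * counterDiag n)) := by group
      have e1 := congrFun (col_mul_counterDiag (τ⁻¹ * τ') j.rev) i
      rw [e] at e1
      simp only [Matrix.col_apply, counterDiag_mul_apply, Fin.rev_rev] at e1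
      rw [← e1, upperGL_apply_eq_zero hv (Fin.rev_lt_rev.2 hij), zero_mul]
    · rw [upperGL_apply_eq_zero hu hij, zero_mul]
  · intro i hi
    have : i = z := Fin.ext (by simp only [z]; omega)
    rw [mul_scalar_apply, Units.val_mk0, this, mul_inv_cancel₀ hd]

end Labels

/-! ### Components and edge paths. -/

namespace PolyComplex

variable {K : PolyComplex}

/-- Being joined by a path is already an equivalence relation, so the generated equivalence adds
nothing. -/
theorem component_eq {x y : K.V}
    (h : (Quot.mk _ x : K.Component) = Quot.mk _ y) : Nonempty (K.EdgePath x y) := by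
  have h' := Quot.eqvGen_exact h
  clear h
  induction h' with
  | rel _ _ h => exact h
  | refl x => exact ⟨⟨[], rfl⟩⟩
  | symm _ _ _ ih => exact ih.map EdgePath.symm
  | trans _ _ _ _ _ ih1 ih2 => exact ih1.elim fun p => ih2.map p.trans

end PolyComplex

theorem IsFrame.of_mul {n : ℕ} {g : Fin 4 → GL (Fin n) ℂ} {p s : Equiv.Perm (Fin 4)}
    {τ : GL (Fin n) ℂ} (h : IsFrame (g ∘ ⇑(p * s)) τ) : IsFrame ((g ∘ p) ∘ s) τ := by
  rw [Function.comp_assoc, ← Equiv.Perm.coe_mul]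
  exact h

namespace ConcreteTriangulation

open Equiv

variable {T : ConcreteTriangulation} {n : ℕ} {D : T.Decoration n}
  {σ : T.complex.Cocycle PGL(n, ℂ)}

/-! ## The canonical lift -/

/-- Arbitrary representatives in GL may be chosen, since the frame conditions do not see scalars. -/
theorem IsNaturalCocycle.exists_frames (hσ : IsNaturalCocycle D σ) (Δ : T.Tet) :
    ∃ τ : Perm (Fin 4) → GL (Fin n) ℂ, (∀ p : Perm (Fin 4), IsFrame (D.rep Δ ∘ p) (τ p)) ∧
      ∀ p, σ.label (Edge.bdry (.middle (Flag.vertex (Δ, p)))) =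
          Matrix.ProjGenLinGroup.mk ((τ p)⁻¹ * τ (p * swap 1 2)) ∧
        σ.label (Edge.bdry (.short (Δ, p))) =
          Matrix.ProjGenLinGroup.mk ((τ p)⁻¹ * τ (p * swap 2 3)) := by
  obtain ⟨τ, h, hl⟩ := hσ Δ
  choose t ht using fun p => Matrix.ProjGenLinGroup.mk_surjective (τ p)
  obtain rfl : (fun p => Matrix.ProjGenLinGroup.mk (t p)) = τ := funext ht
  refine ⟨t, fun p => ?_, fun p => ⟨?_, ?_⟩⟩
  · obtain ⟨m, hm, h0, h1, h2⟩ := h p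
    refine ⟨?_, mem_upperGL_of_cosetB_eq h1, m, hm, mem_upperGL_of_cosetB_eq h2⟩
    simpa using mem_upperGL_of_cosetB_eq h0
  · rw [(hl p).2.1, map_mul, map_inv]
  · rw [(hl p).2.2, map_mul, map_inv]

/-- The normalization of the labels of a canonical lift. -/
def IsCanonicalLabel : T.BdryEdge → GL (Fin n) ℂ → Prop
  | .middle _, A => A.1.BlockTriangular id ∧ ∀ i j : Fin n, j.val + 1 = n → A.1 i j = 1
  | .short _, A => A.1.IsDiag ∧ ∀ i : Fin n, i.val + 1 = n → A.1 i i = 1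

theorem IsCanonicalLabel.mem_cornerOneGL {e : T.BdryEdge} {A : GL (Fin n) ℂ}
    (h : IsCanonicalLabel e A) : A ∈ cornerOneGL n := by
  cases e with
  | middle v => exact ⟨h.1, fun i hi => h.2 i i hi⟩
  | short f => exact ⟨fun i j hij => h.1 (ne_of_gt hij), h.2⟩

theorem isCanonicalLift_iff {L : T.boundary.Cocycle (GL (Fin n) ℂ)} :
    IsCanonicalLift σ L ↔
      (∀ e : T.BdryEdge, Matrix.ProjGenLinGroup.mk (L.label e) = σ.label (Edge.bdry e)) ∧
        ∀ e : T.BdryEdge, IsCanonicalLabel e (L.label e) := by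
  refine and_congr Iff.rfl ⟨fun h e => ?_, fun h => ⟨fun v => h (.middle v), fun f => h (.short f)⟩⟩
  cases e with
  | middle v => exact h.1 v
  | short f => exact h.2 f

theorem IsNaturalCocycle.exists_label (hn : 0 < n) (hσ : IsNaturalCocycle D σ) (e : T.BdryEdge) :
    ∃ A : GL (Fin n) ℂ, Matrix.ProjGenLinGroup.mk A = σ.label (Edge.bdry e) ∧
      IsCanonicalLabel e A := by
  cases e with
  | middle v =>
    -- Either simplex containing the edge may be used: the label of `σ` depends only on the glued
    -- vertex.
    induction v using Quotient.inductionOn with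
    | h f =>
      obtain ⟨Δ, p⟩ := f
      obtain ⟨τ, h, hl⟩ := hσ.exists_frames Δ
      obtain ⟨A, hA, hA'⟩ := (h p).exists_middle_label hn (h (p * swap 1 2)).of_mul
      exact ⟨A, hA.trans (hl p).1.symm, hA'⟩
  | short f =>
    obtain ⟨Δ, p⟩ := f
    obtain ⟨τ, h, hl⟩ := hσ.exists_frames Δ
    obtain ⟨A, hA, hA'⟩ := (h p).exists_short_label hn (h (p * swap 2 3)).of_mul
    exact ⟨A, hA.trans (hl p).2.symm, hA'⟩

theorem prod_map_bdry_label (lab : T.BdryEdge → GL (Fin n) ℂ)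
    (h : ∀ e, Matrix.ProjGenLinGroup.mk (lab e) = σ.label (Edge.bdry e)) (w : List T.BdryEdge) :
    (Matrix.ProjGenLinGroup.mk (w.map lab).prod : PGL(n, ℂ)) =
      ((w.map Edge.bdry).map σ.label).prod := by
  rw [map_list_prod, List.map_map, List.map_map]
  exact congrArg List.prod (List.map_congr_left fun e _ => h e)

theorem prod_map_mem_cornerOneGL {lab : T.BdryEdge → GL (Fin n) ℂ}
    (h : ∀ e, IsCanonicalLabel e (lab e)) (w : List T.BdryEdge) :
    (w.map lab).prod ∈ cornerOneGL n := by
  refine list_prod_mem fun A hA => ?_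
  obtain ⟨e, _, rfl⟩ := List.mem_map.1 hA
  exact (h e).mem_cornerOneGL

theorem IsNaturalCocycle.existsUnique_canonicalLift (hn : 0 < n) (hσ : IsNaturalCocycle D σ) :
    ∃! L, IsCanonicalLift σ L := by
  choose lab hmk hlab using hσ.exists_label hn
  let L : T.boundary.Cocycle (GL (Fin n) ℂ) :=
    { label := lab
      label_rev := fun e => by
        refine eq_of_mk_eq_of_mem_cornerOneGL hn (hlab _).mem_cornerOneGL
          (inv_mem (hlab e).mem_cornerOneGL) ?_
        rw [map_inv, hmk, hmk]
        exact σ.label_rev (Edge.bdry e)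
      prod_face := fun w hw => by
        refine eq_of_mk_eq_of_mem_cornerOneGL hn (prod_map_mem_cornerOneGL hlab w)
          (one_mem _) ?_
        rw [prod_map_bdry_label lab hmk, map_one]
        exact σ.prod_face _ (Face.bdry w hw) }
  refine ⟨L, isCanonicalLift_iff.2 ⟨hmk, hlab⟩, fun L' hL' => ?_⟩
  replace hL' := isCanonicalLift_iff.1 hL'
  refine PolyComplex.Cocycle.ext (funext fun e => ?_)
  exact eq_of_mk_eq_of_mem_cornerOneGL hn (hL'.2 e).mem_cornerOneGL (hlab e).mem_cornerOneGL
    ((hL'.1 e).trans (hmk e).symm)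

/-! ## The diagonal entries of the labels -/

variable {L : T.boundary.Cocycle (GL (Fin n) ℂ)}

theorem single_comp (p : Perm (Fin 4)) (i : Fin 4) (a : ℕ) :
    (Pi.single (p i) a : Fin 4 → ℕ) ∘ p = Pi.single i a := by
  funext j
  simp [Pi.single_apply]

theorem single_add_single_add_single (a b c : ℕ) :
    (Pi.single 2 c + Pi.single 0 a + Pi.single 1 b : Fin 4 → ℕ) = ![a, b, c, 0] := by
  funext i
  fin_cases i <;> simp

theorem single_add_single (a b : ℕ) :
    (Pi.single 0 a + Pi.single 1 b : Fin 4 → ℕ) = ![a, b, 0, 0] := by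
  funext i
  fin_cases i <;> simp

/-- The power `ε` in the statement exactly absorbs the inversion caused by an odd vertex order, so
all later computations take place on the face `012` in standard order. -/
theorem xCoord_reorder (g : Fin 4 → GL (Fin n) ℂ) (p : Perm (Fin 4)) (a b c : ℕ)
    (h : a + b + c = n) :
    xCoord g (Pi.single (p 2) c + Pi.single (p 0) a + Pi.single (p 1) b) ^ (Perm.sign p : ℤ) =
      xCoord (g ∘ p) ![a, b, c, 0] := by
  have e : (Pi.single (p 2) c + Pi.single (p 0) a + Pi.single (p 1) b : Fin 4 → ℕ) ∘ p =
      ![a, b, c, 0] := by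
    rw [← single_add_single_add_single, ← single_comp p 2, ← single_comp p 0, ← single_comp p 1]
    rfl
  rw [← e, xCoord_comp]
  simp only [Pi.add_apply, Finset.sum_add_distrib, Finset.sum_pi_single', Finset.mem_univ, if_true]
  omega

theorem shape_reorder (g : Fin 4 → GL (Fin n) ℂ) (p : Perm (Fin 4)) (a b : ℕ)
    (h : a + b + 2 = n) :
    shape g (Pi.single (p 0) a + Pi.single (p 1) b) (Pi.single (p 0) 1 + Pi.single (p 1) 1) ^
        (Perm.sign p : ℤ) =
      shape (g ∘ p) ![a, b, 0, 0] ![1, 1, 0, 0] := by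
  have e : ∀ a b, (Pi.single (p 0) a + Pi.single (p 1) b : Fin 4 → ℕ) ∘ p = ![a, b, 0, 0] := by
    intro a b
    rw [← single_add_single, ← single_comp p 0, ← single_comp p 1]
    rfl
  have he : (Pi.single (p 0) 1 + Pi.single (p 1) 1 : Fin 4 → ℕ) ∈ simplexEdges := by
    have h := comp_mem_simplexEdges p⁻¹ (by decide : ![1, 1, 0, 0] ∈ simplexEdges)
    rw [← e] at h
    convert h using 1
    funext i
    simp
  rw [← e, ← e, shape_comp _ _ _ _ he]
  simp only [Pi.add_apply, Finset.sum_add_distrib, Finset.sum_pi_single', Finset.mem_univ, if_true]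
  exact h

theorem middleTerm_eq (Δ : T.Tet) (p : Perm (Fin 4)) {l : ℕ} (hl : l + 1 ≤ n) :
    middleTerm D (Δ, p) l =
      -∏ k ∈ Finset.Icc 1 (n - 1 - l), xCoord (D.rep Δ ∘ p) ![l, n - k - l, k, 0] := by
  refine congrArg Neg.neg (Finset.prod_congr rfl fun k hk => ?_)
  rw [Finset.mem_Icc] at hk
  exact xCoord_reorder (D.rep Δ) p l (n - k - l) k (by omega)

theorem shortTerm_eq (Δ : T.Tet) (p : Perm (Fin 4)) {l : ℕ} (hl : 1 ≤ l) (hl' : l + 1 ≤ n) :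
    shortTerm D (Δ, p) l =
      (shape (D.rep Δ ∘ p) ![l - 1, n - 1 - l, 0, 0] ![1, 1, 0, 0])⁻¹ := by
  rw [← shape_reorder (D.rep Δ) p (l - 1) (n - 1 - l) (by omega), ← zpow_neg]
  rfl

theorem Decoration.IsGeneric.comp (hD : D.IsGeneric) (Δ : T.Tet) (p : Perm (Fin 4))
    (t : Fin 4 → ℕ) (ht : ∑ i, t i = n) : ptolemy (D.rep Δ ∘ p) t ≠ 0 := by
  have hs : ∑ i, (t ∘ ⇑p⁻¹) i = n := (Equiv.sum_comp p⁻¹ t).trans ht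
  have e : (t ∘ ⇑p⁻¹) ∘ p = t := by
    funext i
    simp
  have h := (ptolemy_comp_ne_zero_iff (D.rep Δ) (t ∘ ⇑p⁻¹) hs p).2 (hD Δ _ hs)
  rwa [e] at h

/-- Quotients of diagonal entries ignore scalars, so they can be computed from `τ⁻¹ * τ'` in place
of the normalized lift. -/
theorem diagEntry_ratio_eq {A B : GL (Fin n) ℂ}
    (h : (Matrix.ProjGenLinGroup.mk A : PGL(n, ℂ)) = Matrix.ProjGenLinGroup.mk B)
    (i j : Fin n) (hij : j.val = i.val + 1) :
    diagEntry A j / diagEntry A (j + 1) = B.1 i i / B.1 j j := by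
  obtain ⟨u, hu⟩ := exists_apply_eq_mul_of_mk_eq h
  rw [diagEntry_eq A i hij, diagEntry_eq A j rfl, hu, hu, mul_div_mul_left _ _ u.ne_zero]

theorem IsCanonicalLift.middle_ratio (hD : D.IsGeneric) (hσ : IsNaturalCocycle D σ)
    (hL : IsCanonicalLift σ L) (f : T.Flag) {l : ℕ} (hl : l ∈ Finset.Icc 1 (n - 1)) :
    diagEntry (L.label (.middle f.vertex)) l / diagEntry (L.label (.middle f.vertex)) (l + 1) =
      middleTerm D f l := by
  rw [Finset.mem_Icc] at hl
  obtain ⟨Δ, p⟩ := f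
  obtain ⟨τ, h, hlab⟩ := hσ.exists_frames Δ
  have hmk := (hL.1 (.middle (Flag.vertex (Δ, p)))).trans (hlab p).1
  rw [middleTerm_eq Δ p (by omega)]
  -- Levels count from 1 and matrix indices from 0: levels `l` and `l + 1` sit at indices `l - 1`
  -- and `l`.
  exact (diagEntry_ratio_eq hmk ⟨l - 1, by omega⟩ ⟨l, by omega⟩ (by simp only; omega)).trans
    (diag_ratio_middle (hD.comp Δ p) (h p) (h (p * swap 1 2)).of_mul _ _ (by simp only; omega))

theorem IsCanonicalLift.short_ratio (hD : D.IsGeneric) (hσ : IsNaturalCocycle D σ)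
    (hL : IsCanonicalLift σ L) (f : T.Flag) {l : ℕ} (hl : l ∈ Finset.Icc 1 (n - 1)) :
    diagEntry (L.label (.short f)) l / diagEntry (L.label (.short f)) (l + 1) =
      shortTerm D f l := by
  rw [Finset.mem_Icc] at hl
  obtain ⟨Δ, p⟩ := f
  obtain ⟨τ, h, hlab⟩ := hσ.exists_frames Δ
  have hmk := (hL.1 (.short (Δ, p))).trans (hlab p).2
  rw [shortTerm_eq Δ p (by omega) (by omega)]
  exact (diagEntry_ratio_eq hmk ⟨l - 1, by omega⟩ ⟨l, by omega⟩ (by simp only; omega)).trans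
    (diag_ratio_short (hD.comp Δ p) (h p) (h (p * swap 2 3)).of_mul _ _ (by simp only; omega))

/-! ## Cusp equations -/

theorem diagEntry_prod (hL : IsCanonicalLift σ L) {l : ℕ} (hl : 1 ≤ l) (hl' : l ≤ n)
    (w : List T.BdryEdge) :
    diagEntry (w.map L.label).prod l = (w.map fun e => diagEntry (L.label e) l).prod := by
  have hc := (isCanonicalLift_iff.1 hL).2
  induction w with
  | nil =>
    rw [diagEntry_eq _ ⟨l - 1, by omega⟩ (by simp only; omega)]
    simp
  | cons e w ih =>
    rw [List.map_cons, List.prod_cons, diagEntry_mul (hc e).mem_cornerOneGL.1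
      (prod_map_mem_cornerOneGL hc w).1, ih, List.map_cons, List.prod_cons]

/-- The product is triangular and its `n`-th diagonal entry is 1 by normalization, so levels up to
`n - 1` account for the whole diagonal. -/
theorem cuspEquations_iff_mem_unipotentGL (hn : 0 < n) (hL : IsCanonicalLift σ L)
    {x y : T.Vertex} (p : T.boundary.EdgePath x y) :
    (∀ l ∈ Finset.Icc 1 (n - 1), CuspEquation L p l) ↔
      (p.1.map L.label).prod ∈ unipotentGL n := by
  have hc := prod_map_mem_cornerOneGL (isCanonicalLift_iff.1 hL).2 p.1
  constructor
  · refine fun h => ⟨hc.1, fun i => ?_⟩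
    have hi := i.2
    by_cases hin : i.val + 1 = n
    · exact hc.2 i hin
    · have := h (i + 1) (Finset.mem_Icc.2 ⟨by omega, by omega⟩)
      rwa [CuspEquation, ← diagEntry_prod hL (by omega) (by omega), diagEntry_eq _ i rfl] at this
  · intro h l hl
    rw [Finset.mem_Icc] at hl
    rw [CuspEquation, ← diagEntry_prod hL (by omega) (by omega),
      diagEntry_eq _ ⟨l - 1, by omega⟩ (by simp only; omega)]
    exact h.2 _

theorem cuspEquations_iff_ratioCuspEquations (hn : 0 < n) (hL : IsCanonicalLift σ L)
    {x y : T.Vertex} (p : T.boundary.EdgePath x y) :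
    (∀ l ∈ Finset.Icc 1 (n - 1), CuspEquation L p l) ↔
      ∀ l ∈ Finset.Icc 1 (n - 1), RatioCuspEquation L p l := by
  set P : ℕ → ℂ := fun l => (p.1.map fun e => diagEntry (L.label e) l).prod
  have hr : ∀ l, RatioCuspEquation L p l ↔ P l / P (l + 1) = 1 := by
    intro l
    have h := Multiset.prod_map_div (m := (p.1 : Multiset T.BdryEdge))
      (f := fun e => diagEntry (L.label e) l) (g := fun e => diagEntry (L.label e) (l + 1))
    simp only [Multiset.map_coe, Multiset.prod_coe] at h
    rw [RatioCuspEquation, h]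
  have hP : P n = 1 := by
    have hc := prod_map_mem_cornerOneGL (isCanonicalLift_iff.1 hL).2 p.1
    change (p.1.map fun e => diagEntry (L.label e) n).prod = 1
    rw [← diagEntry_prod hL hn le_rfl, diagEntry_eq _ ⟨n - 1, by omega⟩ (by simp only; omega)]
    exact hc.2 _ (by simp only; omega)
  constructor
  · intro h l hl
    rw [Finset.mem_Icc] at hl
    have h1 : P l = 1 := h l (Finset.mem_Icc.2 hl)
    have h2 : P (l + 1) = 1 := by
      rcases Nat.lt_or_ge l (n - 1) with h' | h'
      · exact h (l + 1) (Finset.mem_Icc.2 ⟨by omega, by omega⟩)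
      · rw [show l + 1 = n by omega, hP]
    rw [hr, h1, h2, div_one]
  · intro h
    -- The ratio equations say that `P` is constant on `1, …, n`; descending from the automatic
    -- value `P n = 1` determines it.
    have key : ∀ k, k < n → P (n - k) = 1 := by
      intro k
      induction k with
      | zero => exact fun _ => hP
      | succ k ih =>
        intro hk
        have := (hr _).1 (h (n - (k + 1)) (Finset.mem_Icc.2 ⟨by omega, by omega⟩))
        rwa [show n - (k + 1) + 1 = n - k by omega, ih (by omega), div_one] at this
    intro l hl
    rw [Finset.mem_Icc] at hl
    have := key (n - l) (by omega)
    rwa [Nat.sub_sub_self (by omega)] at this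

theorem ratioCuspEquation_iff_shapeCuspEquation (hD : D.IsGeneric) (hσ : IsNaturalCocycle D σ)
    (hL : IsCanonicalLift σ L) {r : T.Vertex → T.Flag} (hr : ∀ v, (r v).vertex = v)
    {x y : T.Vertex} (p : T.boundary.EdgePath x y) {l : ℕ} (hl : l ∈ Finset.Icc 1 (n - 1)) :
    RatioCuspEquation L p l ↔ ShapeCuspEquation D r p l := by
  rw [RatioCuspEquation, ShapeCuspEquation]
  refine iff_of_eq (congrArg (· = 1) (congrArg List.prod (List.map_congr_left fun e _ => ?_)))
  cases e with
  | middle v =>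
    have := hL.middle_ratio hD hσ (r v) hl
    rwa [hr v] at this
  | short f => exact hL.short_ratio hD hσ f hl

/-! ## Peripheral elements -/

/-- This trades the boundary part of the holonomy for the lift, where diagonal entries make sense;
the tail only conjugates. -/
theorem holonomy_peripheral (hL : IsCanonicalLift σ L) {x y : T.Vertex}
    (p : T.complex.EdgePath x y) (l : T.boundary.EdgePath y y) :
    σ.holonomy x (peripheral p l) = (p.1.map σ.label).prod *
      Matrix.ProjGenLinGroup.mk (l.1.map L.label).prod * ((p.1.map σ.label).prod)⁻¹ := by
  rw [prod_map_bdry_label L.label hL.1, ← σ.prod_inv, ← List.prod_append, ← List.prod_append,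
    ← List.map_append, ← List.map_append]
  rfl

theorem mem_unipotentGL_of_generators {y : T.Vertex}
    {S : Set (T.boundary.EdgePath y y)}
    (hS : Subgroup.closure (PolyComplex.toFundGroup '' S) = ⊤)
    (h : ∀ p ∈ S, (p.1.map L.label).prod ∈ unipotentGL n) (l : T.boundary.EdgePath y y) :
    (l.1.map L.label).prod ∈ unipotentGL n := by
  have hle : Subgroup.closure (PolyComplex.toFundGroup '' S) ≤
      (unipotentGL n).comap (L.holonomy y) := by
    rw [Subgroup.closure_le]
    rintro _ ⟨p, hp, rfl⟩
    exact h p hp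
  rw [hS] at hle
  exact hle (Subgroup.mem_top (PolyComplex.toFundGroup l))

end ConcreteTriangulation

/-! ### Equivalence of the unipotency conditions, and assembly of the theorem. -/

open ConcreteTriangulation in
theorem isBoundaryUnipotent_tfae {n : ℕ} (hn : 0 < n) {T : ConcreteTriangulation}
    (hT : T.complex.IsConnected) {σ : T.complex.Cocycle PGL(n, ℂ)}
    {x : T.Vertex} {ρ : T.complex.FundGroup x →* PGL(n, ℂ)}
    (hρ : ∃ g : PGL(n, ℂ), ∀ a, ρ a = g * σ.holonomy x a * g⁻¹)
    {b : T.boundary.Component → T.Vertex} (hb : ∀ c, Quot.mk _ (b c) = c)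
    {S : ∀ c, Set (T.boundary.EdgePath (b c) (b c))}
    (hS : ∀ c, Subgroup.closure (PolyComplex.toFundGroup '' S c) = ⊤)
    {L : T.boundary.Cocycle (GL (Fin n) ℂ)} (hL : IsCanonicalLift σ L) :
    List.TFAE [IsBoundaryUnipotent ρ, IsPeripherallyUnipotent ρ,
      ∀ c, ∀ p ∈ S c, ∀ l ∈ Finset.Icc 1 (n - 1), CuspEquation L p l] := by
  obtain ⟨g, hg⟩ := hρ
  have hc := (isCanonicalLift_iff.1 hL).2
  tfae_have 2 → 1 := by
    intro h y p l
    obtain ⟨k, hk⟩ := h y p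
    exact ⟨k, hk l⟩
  tfae_have 1 → 3 := by
    intro h c p _
    rw [cuspEquations_iff_mem_unipotentGL hn hL]
    obtain ⟨q⟩ := hT.2 x (b c)
    obtain ⟨k, u, hu, e⟩ := h (b c) q p
    rw [hg, holonomy_peripheral hL] at e
    -- This conjugator undoes both the path `q` to the base point and the conjugation relating `ρ`
    -- to the holonomy of `σ`.
    refine mem_unipotentGL_of_mk_eq_conj hn (prod_map_mem_cornerOneGL hc p.1)
      (h := ((q.1.map σ.label).prod)⁻¹ * g⁻¹ * k) hu ?_
    generalize (q.1.map σ.label).prod = Q at *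
    generalize Matrix.ProjGenLinGroup.mk (p.1.map L.label).prod = X at *
    have : X = Q⁻¹ * g⁻¹ * (g * (Q * X * Q⁻¹) * g⁻¹) * g * Q := by group
    rw [this, e]
    group
  tfae_have 3 → 2 := by
    intro h y p
    -- The conjugator depends on the path `p` alone, so it serves the whole peripheral subgroup at
    -- once.
    refine ⟨g * (p.1.map σ.label).prod, fun l => ?_⟩
    -- Generators are known only at the chosen base point; `q` runs from there to `y` inside the
    -- boundary.
    obtain ⟨q⟩ := PolyComplex.component_eq (hb (Quot.mk _ y))
    have hu := mem_unipotentGL_of_generators (hS (Quot.mk _ y))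
      (fun s hs => (cuspEquations_iff_mem_unipotentGL hn hL s).1 (h _ s hs))
      ((q.trans l).trans q.symm)
    have e : (((q.trans l).trans q.symm).1.map L.label).prod =
        (q.1.map L.label).prod * (l.1.map L.label).prod * ((q.1.map L.label).prod)⁻¹ := by
      rw [← L.prod_inv, ← List.prod_append, ← List.prod_append, ← List.map_append,
        ← List.map_append]
      rfl
    rw [e] at hu
    -- As `q` stays in the boundary, its lifted label is triangular, so moving the loop back to `y`
    -- preserves unipotency without changing the conjugator.
    have hX := mul_inv_conj_mem_unipotentGL (prod_map_mem_cornerOneGL hc q.1).1 hu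
    refine ⟨_, ⟨_, hX, rfl⟩, ?_⟩
    rw [hg, holonomy_peripheral hL]
    have e' : ((q.1.map L.label).prod)⁻¹ * ((q.1.map L.label).prod * (l.1.map L.label).prod *
        ((q.1.map L.label).prod)⁻¹) * (q.1.map L.label).prod = (l.1.map L.label).prod := by
      group
    rw [e']
    group
  tfae_finish

theorem mainTheorem9 (n : ℕ) (hn : 2 ≤ n) (T : ConcreteTriangulation)
    (hT : T.complex.IsConnected)
    (D : T.Decoration n) (hD : D.IsGeneric)
    (σ : T.complex.Cocycle PGL(n, ℂ)) (hσ : ConcreteTriangulation.IsNaturalCocycle D σ)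
    (x : T.Vertex) (ρ : T.complex.FundGroup x →* PGL(n, ℂ))
    (hρ : ∃ g : PGL(n, ℂ), ∀ a, ρ a = g * σ.holonomy x a * g⁻¹)
    (b : T.boundary.Component → T.Vertex) (hb : ∀ c, Quot.mk _ (b c) = c)
    (S : ∀ c, Set (T.boundary.EdgePath (b c) (b c)))
    (hS : ∀ c, Subgroup.closure (PolyComplex.toFundGroup '' S c) = ⊤)
    (r : T.Vertex → T.Flag) (hr : ∀ v, (r v).vertex = v) :
    (∃! L, ConcreteTriangulation.IsCanonicalLift σ L) ∧
    ∀ L, ConcreteTriangulation.IsCanonicalLift σ L →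
      List.TFAE [
        ConcreteTriangulation.IsBoundaryUnipotent ρ,
        ConcreteTriangulation.IsPeripherallyUnipotent ρ,
        ∀ c, ∀ p ∈ S c, ∀ l ∈ Finset.Icc 1 (n - 1), ConcreteTriangulation.CuspEquation L p l,
        ∀ c, ∀ p ∈ S c, ∀ l ∈ Finset.Icc 1 (n - 1),
          ConcreteTriangulation.RatioCuspEquation L p l,
        ∀ c, ∀ p ∈ S c, ∀ l ∈ Finset.Icc 1 (n - 1),
          ConcreteTriangulation.ShapeCuspEquation D r p l] ∧
      (∀ (y : T.Vertex) (p : T.boundary.EdgePath y y), List.TFAE [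
        ∀ l ∈ Finset.Icc 1 (n - 1), ConcreteTriangulation.CuspEquation L p l,
        ∀ l ∈ Finset.Icc 1 (n - 1), ConcreteTriangulation.RatioCuspEquation L p l,
        ∀ l ∈ Finset.Icc 1 (n - 1), ConcreteTriangulation.ShapeCuspEquation D r p l]) ∧
      ∀ (f : T.Flag), ∀ l ∈ Finset.Icc 1 (n - 1),
        ConcreteTriangulation.diagEntry (L.label (.middle f.vertex)) l /
            ConcreteTriangulation.diagEntry (L.label (.middle f.vertex)) (l + 1) =
          ConcreteTriangulation.middleTerm D f l ∧
        ConcreteTriangulation.diagEntry (L.label (.short f)) l /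
            ConcreteTriangulation.diagEntry (L.label (.short f)) (l + 1) =
          ConcreteTriangulation.shortTerm D f l := by
  have hn0 : 0 < n := by omega
  refine ⟨hσ.existsUnique_canonicalLift hn0, fun L hL => ⟨?_, ?_, ?_⟩⟩
  · have h := isBoundaryUnipotent_tfae hn0 hT hρ hb hS hL
    tfae_have 1 ↔ 2 := h.out 0 1
    tfae_have 2 ↔ 3 := h.out 1 2
    tfae_have 3 ↔ 4 := forall_congr' fun c => forall₂_congr fun p _ =>
      ConcreteTriangulation.cuspEquations_iff_ratioCuspEquations hn0 hL p
    tfae_have 4 ↔ 5 := forall_congr' fun c => forall₂_congr fun p _ => forall₂_congr fun l hl =>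
      ConcreteTriangulation.ratioCuspEquation_iff_shapeCuspEquation hD hσ hL hr p hl
    tfae_finish
  · intro y p
    tfae_have 1 ↔ 2 := ConcreteTriangulation.cuspEquations_iff_ratioCuspEquations hn0 hL p
    tfae_have 2 ↔ 3 := forall₂_congr fun l hl =>
      ConcreteTriangulation.ratioCuspEquation_iff_shapeCuspEquation hD hσ hL hr p hl
    tfae_finish
  · exact fun f l hl => ⟨hL.middle_ratio hD hσ f hl, hL.short_ratio hD hσ f hl⟩
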